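/- \textbf{Theorem.} Let $C\ge 1$, and let $\xi^-=\xi^-(C)$ and $\xi^+=\xi^+(C)$ be the unique solutions of $e^{-\xi}=C(1-\xi)$ with $-\infty<\xi^-\le 0\le\xi^+<1$. Let $Q\subset\mathbb{R}$ be a bounded nondegenerate interval, write $\langle f\rangle_J=\frac1{|J|}\int_J f$, and let $A_\infty^C(Q)$ be the set of a.e. positive functions $w$ on $Q$ such that $w$ and $\log w$ are integrable on $Q$ and $$[w]_{A_\infty(Q)}:=\sup_{J\subset Q}\langle w\rangle_J\,e^{-\langle \log w\rangle_J}\le C,$$ the supremum being over all nondegenerate subintervals $J$ of $Q$. For $\lambda\in\mathbb{R}$ put $$ F_C(\lambda)=\begin{cases} 1,& \lambda\le 0,\\[1mm] 1-\dfrac{\lambda}{\xi^+-\xi^-},& 0\le\lambda\le-\xi^-,\\[2mm] \dfrac{\xi^+e^{-\xi^- /\xi^+}}{\xi^+-\xi^-}\,e^{-\lambda/\xi^+},&\lambda\ge-\xi^-, \end{cases} $$ where for $C=1$ (when $\xi^\pm=0$) this is understood as $F_1(\lambda)=1$ for $\lambda\le0$ and $F_1(\lambda)=0$ for $\lambda>0$.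 If $e^\varphi\in A_\infty^C(Q)$, then for every $\lambda\in\mathbb{R}$ and every nondegenerate subinterval $J$ of $Q$, $$\frac1{|J|}\,\big|\{t\in J:\ \varphi(t)-\langle\varphi\rangle_J\ge\lambda\}\big|\le F_C(\lambda).$$ This inequality is sharp for each value of $\lambda$: for every $C\ge1$, every such $Q$ and every $\lambda\in\mathbb{R}$ there is a function $\varphi$ with $e^\varphi\in A_\infty^C(Q)$ for which equality holds with $J=Q$. -/

import Mathlib

open MeasureTheory Set
open scoped ENNReal

noncomputable section

/-- A weight on the bounded interval with endpoints `a < b`: `w` and `log w` are integrable on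
`[a, b]` (for a compact interval this is local integrability) and `w` is positive a.e. there. -/
structure IsLogIntegrableWeight (w : ℝ → ℝ) (a b : ℝ) : Prop where
  pos : ∀ᵐ t ∂(volume.restrict (Icc a b)), 0 < w t
  integrable : IntegrableOn w (Icc a b) volume
  integrable_log : IntegrableOn (fun t => Real.log (w t)) (Icc a b) volume

/-- The `A_∞`-characteristic of `w` on `Q = [a, b]`: the supremum of `⟨w⟩_J exp (-⟨log w⟩_J)` over
all nondegenerate subintervals `J = [c, d]` of `Q`, with values in `[0, ∞]`. -/
def aInftyChar (w : ℝ → ℝ) (a b : ℝ) : ℝ≥0∞ :=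
  ⨆ (c : ℝ) (d : ℝ) (_ : a ≤ c) (_ : c < d) (_ : d ≤ b),
    ENNReal.ofReal ((⨍ t in Icc c d, w t) * Real.exp (-(⨍ t in Icc c d, Real.log (w t))))

/-- The class `A_∞(Q)`, `Q = [a, b]`. -/
def AInfty (a b : ℝ) : Set (ℝ → ℝ) :=
  {w | IsLogIntegrableWeight w a b ∧ aInftyChar w a b < ∞}

/-- The class `A_∞^C(Q)`, `Q = [a, b]`. -/
def AInftyLE (C a b : ℝ) : Set (ℝ → ℝ) :=
  {w | w ∈ AInfty a b ∧ aInftyChar w a b ≤ ENNReal.ofReal C}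

/-- The solution `ξ⁺ = ξ⁺(C)` of `e^{-ξ} = C (1 - ξ)` in `[0, 1)`; for `C ≥ 1` there is exactly
one, see `xiPlus_spec` and `eq_xiPlus`. -/
def xiPlus (C : ℝ) : ℝ :=
  sSup {ξ : ℝ | 0 ≤ ξ ∧ ξ < 1 ∧ Real.exp (-ξ) = C * (1 - ξ)}

/-- The solution `ξ⁻ = ξ⁻(C)` of `e^{-ξ} = C (1 - ξ)` in `(-∞, 0]`; for `C ≥ 1` there is exactly
one, see `xiMinus_spec` and `eq_xiMinus`. -/
def xiMinus (C : ℝ) : ℝ :=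
  sInf {ξ : ℝ | ξ ≤ 0 ∧ Real.exp (-ξ) = C * (1 - ξ)}

theorem xi_plus_unique {C x y : ℝ} (hC : 1 ≤ C) (hx0 : 0 ≤ x) (hy1 : y < 1)
    (hx : Real.exp (-x) = C * (1 - x)) (hy : Real.exp (-y) = C * (1 - y)) : y ≤ x := by
  by_contra! h
  have h1 : -(y - x) + 1 < Real.exp (-(y - x)) := Real.add_one_lt_exp (by linarith)
  have h2 : Real.exp (-y) = Real.exp (-x) * Real.exp (-(y - x)) := by
    rw [← Real.exp_add]; congr 1; ring
  have h3 : 0 < C * (1 - x) := mul_pos (by linarith) (by linarith)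
  rw [hy, hx] at h2
  nlinarith [mul_lt_mul_of_pos_left h1 h3, mul_nonneg (mul_nonneg (by linarith : (0:ℝ) ≤ C) hx0)
    (by linarith : (0:ℝ) ≤ y - x)]

theorem xi_minus_unique {C x y : ℝ} (hC : 1 ≤ C) (hy0 : y ≤ 0)
    (hx : Real.exp (-x) = C * (1 - x)) (hy : Real.exp (-y) = C * (1 - y)) : y ≤ x := by
  by_contra! h
  have h1 : (y - x) + 1 < Real.exp (y - x) := Real.add_one_lt_exp (by linarith)
  have h2 : Real.exp (-x) = Real.exp (-y) * Real.exp (y - x) := by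
    rw [← Real.exp_add]; congr 1; ring
  have h3 : 0 < C * (1 - y) := mul_pos (by linarith) (by linarith)
  rw [hy, hx] at h2
  nlinarith [mul_lt_mul_of_pos_left h1 h3, mul_nonneg (mul_nonneg (by linarith : (0:ℝ) ≤ C)
    (by linarith : (0:ℝ) ≤ -y)) (by linarith : (0:ℝ) ≤ y - x)]

theorem eq_xiPlus {C ξ : ℝ} (hC : 1 ≤ C) (h0 : 0 ≤ ξ) (h1 : ξ < 1)
    (h : Real.exp (-ξ) = C * (1 - ξ)) : ξ = xiPlus C := by
  have : {ξ : ℝ | 0 ≤ ξ ∧ ξ < 1 ∧ Real.exp (-ξ) = C * (1 - ξ)} = {ξ} := by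
    ext y
    constructor
    · rintro ⟨hy0, hy1, hy⟩
      exact le_antisymm (xi_plus_unique hC h0 hy1 h hy) (xi_plus_unique hC hy0 h1 hy h)
    · rintro rfl
      exact ⟨h0, h1, h⟩
  rw [xiPlus, this, csSup_singleton]

theorem eq_xiMinus {C ξ : ℝ} (hC : 1 ≤ C) (h0 : ξ ≤ 0)
    (h : Real.exp (-ξ) = C * (1 - ξ)) : ξ = xiMinus C := by
  have : {ξ : ℝ | ξ ≤ 0 ∧ Real.exp (-ξ) = C * (1 - ξ)} = {ξ} := by
    ext y
    constructor
    · rintro ⟨hy0, hy⟩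
      exact le_antisymm (xi_minus_unique hC hy0 h hy) (xi_minus_unique hC h0 hy h)
    · rintro rfl
      exact ⟨h0, h⟩
  rw [xiMinus, this, csInf_singleton]

theorem xiPlus_spec {C : ℝ} (hC : 1 ≤ C) :
    0 ≤ xiPlus C ∧ xiPlus C < 1 ∧ Real.exp (-xiPlus C) = C * (1 - xiPlus C) := by
  have hc : ContinuousOn (fun ξ : ℝ => C * (1 - ξ) - Real.exp (-ξ)) (Icc 0 1) := by fun_prop
  obtain ⟨ξ, ⟨h0, h1⟩, h⟩ := intermediate_value_Icc' (zero_le_one' ℝ) hc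
    (show (0 : ℝ) ∈ Icc _ _ from ⟨by simpa using (Real.exp_pos (-1)).le, by simpa using hC⟩)
  have h' : Real.exp (-ξ) = C * (1 - ξ) := by simp only at h; linarith
  have h1' : ξ < 1 := by
    rcases h1.lt_or_eq with h2 | h2
    · exact h2
    · subst h2
      have := Real.exp_pos (-1)
      simp only [sub_self, mul_zero] at h'
      linarith
  rw [← eq_xiPlus hC h0 h1' h']
  exact ⟨h0, h1', h'⟩

theorem xiMinus_spec {C : ℝ} (hC : 1 ≤ C) :
    xiMinus C ≤ 0 ∧ Real.exp (-xiMinus C) = C * (1 - xiMinus C) := by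
  have hc : ContinuousOn (fun ξ : ℝ => C * (1 - ξ) - Real.exp (-ξ)) (Icc (-(2 * C)) 0) := by
    fun_prop
  have hq := Real.quadratic_le_exp_of_nonneg (by linarith : (0 : ℝ) ≤ 2 * C)
  obtain ⟨ξ, ⟨_, h0⟩, h⟩ := intermediate_value_Icc (by linarith : -(2 * C) ≤ 0) hc
    (show (0 : ℝ) ∈ Icc _ _ from ⟨by simp only [neg_neg]; nlinarith, by simpa using hC⟩)
  have h' : Real.exp (-ξ) = C * (1 - ξ) := by simp only at h; linarith
  rw [← eq_xiMinus hC h0 h']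
  exact ⟨h0, h'⟩

/-- The right-hand side of the distribution estimate. The adjacent cases agree at the common
endpoints. For `C = 1` one has `ξ⁺ = ξ⁻ = 0` and the last expression (a quotient `0 / 0`) is read,
for `λ > 0`, as its limit `0` when `C` decreases to `1`. -/
def distBound (C lam : ℝ) : ℝ :=
  if lam ≤ 0 then 1
  else if C = 1 then 0
  else if lam ≤ -xiMinus C then 1 - lam / (xiPlus C - xiMinus C)
  else xiPlus C * Real.exp (-xiMinus C / xiPlus C) / (xiPlus C - xiMinus C)
    * Real.exp (-lam / xiPlus C)

/-- `|{t ∈ J : φ(t) - ⟨φ⟩_J ≥ λ}| / |J|` for `J = [c, d]`. -/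
def upperProportion (φ : ℝ → ℝ) (c d lam : ℝ) : ℝ :=
  (volume {t ∈ Icc c d | lam ≤ φ t - ⨍ s in Icc c d, φ s}).toReal / (d - c)

end

/-! Write `ξ = ξ⁺` and `η = ξ⁻`, and let `C > 1`. The equation defining them says that the tangent
line to `C e^r` at `r = u`, namely `C e^u (1 - u + r)`, meets the curve `e^r` at `r = u - ξ` and `r
= u - η`. This chord governs both the estimate and its extremal functions.

Upper bound. Let `φ` have mean `m` on `J`, and write the threshold `m + λ` as `u - η`. The rising
sun lemma yields an open set `E ⊆ J` on each of whose components the mean of `φ` is exactly `u`, so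
that `∫_E e^φ ≤ C e^u |E|`. Chebyshev's inequality for the gap between `e^φ` and the tangent line of
the exponential at `u - ξ` then bounds the level set inside `E` (`measureReal_chord_le`). If `u ≤
m`, then `φ ≥ u` a.e. off `E`, and Chebyshev for `φ - (u - ξ)` there completes the linear bound. If
`u > m`, then `φ ≤ u` a.e. off `E`, and the sets `E_α`, `m ≤ α ≤ u`, decrease from `J` to `E_u`.
With `T = |E_α|` and `H = ∫_{E_α} e^φ`, the quantity `e^{α(1/ξ-1)} (H - C e^α (1 - ξ²) T)` does not
increase in `α` (`exp_potential_le`), which produces the factor `e^{(m-u)/ξ}`. For `C = 1`, equality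
in Jensen's inequality makes `φ` constant a.e.

Sharpness. The extremal functions are nonincreasing: two values spanning one chord in the linear
range, and a logarithm capped by such a step in the exponential range. The logarithm is chosen so
that the initial intervals ending on it attain the constant `C` exactly; subtracting a piece where
the chord lies below the exponential handles the other intervals. -/

/-! ### The rising sun lemma for a continuous function -/

/-- The points of `(c, d)` from which a later value of `Φ` exceeds `min (Φ t) 0`. -/
def risingSet (Φ : ℝ → ℝ) (c d : ℝ) : Set ℝ :=
  {t | t ∈ Ioo c d ∧ ∃ s, t < s ∧ s ≤ d ∧ min (Φ t) 0 < Φ s}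

theorem risingSet_subset (Φ : ℝ → ℝ) (c d : ℝ) : risingSet Φ c d ⊆ Ioo c d := fun _ h => h.1

theorem isOpen_risingSet {Φ : ℝ → ℝ} {c d : ℝ} (hΦ : ContinuousOn Φ (Icc c d)) :
    IsOpen (risingSet Φ c d) := by
  rw [isOpen_iff_mem_nhds]
  rintro t ⟨ht, s, hts, hsd, hs⟩
  have h1 : ContinuousAt Φ t := hΦ.continuousAt (Icc_mem_nhds ht.1 ht.2)
  have h2 : ContinuousAt (fun t => min (Φ t) 0) t := h1.inf continuousAt_const
  filter_upwards [Ioo_mem_nhds ht.1 ht.2, Iio_mem_nhds hts, h2.eventually_lt_const hs]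
    with x hx1 hx2 hx3 using ⟨hx1, s, hx2, hsd, hx3⟩

theorem le_of_notMem_risingSet {Φ : ℝ → ℝ} {c d b : ℝ} (hΦ : ContinuousOn Φ (Icc c d))
    (hd : Φ d < 0) (hcb : c < b) (hbd : b ≤ d) (hb : b ∉ risingSet Φ c d) :
    Φ b ≤ 0 ∧ ∀ s, b ≤ s → s ≤ d → Φ s ≤ Φ b := by
  rcases hbd.eq_or_lt with rfl | hbd
  · exact ⟨hd.le, fun s h1 h2 => by rw [le_antisymm h1 h2]⟩
  have key : ∀ s, b < s → s ≤ d → Φ s ≤ min (Φ b) 0 := by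
    intro s h1 h2
    by_contra! h
    exact hb ⟨⟨hcb, hbd⟩, s, h1, h2, h⟩
  refine ⟨?_, fun s h1 h2 => ?_⟩
  · by_contra! h
    obtain ⟨s, hs, hs'⟩ := intermediate_value_Ioo' hbd.le (hΦ.mono (Icc_subset_Icc_left hcb.le))
      (show Φ b / 2 ∈ Ioo (Φ d) (Φ b) from ⟨by linarith, by linarith⟩)
    have := (key s hs.1 hs.2.le).trans (min_le_right _ _)
    linarith
  · rcases h1.eq_or_lt with rfl | h1
    · exact le_rfl
    · exact (key s h1 h2).trans (min_le_left _ _)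

/-- If `Φ b < y < Φ a`, the last point of `[a, b]` where `Φ ≥ y` lies in the rising set, yet nothing
after it exceeds `y`. The minimum with `0` in `risingSet` serves the component starting at `c`: it
forces `Φ b ≤ 0 = Φ c`, where the classical set would only give `Φ c ≤ Φ b`. -/
theorem eq_of_component_risingSet {Φ : ℝ → ℝ} {c d a b : ℝ} (hΦ : ContinuousOn Φ (Icc c d))
    (hc : Φ c = 0) (hd : Φ d < 0) (hab : a < b) (hca : c ≤ a) (hbd : b ≤ d)
    (h : Ioo a b ⊆ risingSet Φ c d)
    (ha : a ∉ risingSet Φ c d) (hb : b ∉ risingSet Φ c d) : Φ a = Φ b := by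
  obtain ⟨hb0, hb1⟩ := le_of_notMem_risingSet hΦ hd (hca.trans_lt hab) hbd hb
  have ha1 : Φ b ≤ Φ a ∧ Φ a ≤ 0 := by
    rcases hca.eq_or_lt with rfl | hca
    · rw [hc]; exact ⟨hb0, le_rfl⟩
    · obtain ⟨ha0, ha1⟩ := le_of_notMem_risingSet hΦ hd hca (hab.le.trans hbd) ha
      exact ⟨ha1 b hab.le hbd, ha0⟩
  refine le_antisymm ?_ ha1.1
  by_contra! hlt
  obtain ⟨y, hy1, hy2⟩ := exists_between hlt
  have hcont : ContinuousOn Φ (Icc a b) := hΦ.mono (Icc_subset_Icc hca hbd)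
  have hcl : IsCompact (Icc a b ∩ Φ ⁻¹' Ici y) :=
    isCompact_Icc.of_isClosed_subset (hcont.preimage_isClosed_of_isClosed isClosed_Icc isClosed_Ici)
      inter_subset_left
  obtain ⟨t, ⟨ht1, ht2⟩, ht3⟩ := hcl.exists_isGreatest ⟨a, ⟨le_rfl, hab.le⟩, hy2.le⟩
  have ht2 : y ≤ Φ t := ht2
  have htb : t < b := lt_of_le_of_ne ht1.2 (by rintro rfl; linarith)
  have hty : Φ t = y := by
    refine le_antisymm ?_ ht2
    by_contra! h3
    obtain ⟨s, hs, hs'⟩ := intermediate_value_Ioo' htb.le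
      (hcont.mono (Icc_subset_Icc_left ht1.1)) (show y ∈ Ioo (Φ b) (Φ t) from ⟨hy1, h3⟩)
    exact absurd (ht3 ⟨⟨ht1.1.trans hs.1.le, hs.2.le⟩, hs'.ge⟩) (not_le.2 hs.1)
  have hat : a < t := lt_of_le_of_ne ht1.1 (by rintro rfl; linarith)
  obtain ⟨_, s, hts, hsd, hs⟩ := h ⟨hat, htb⟩
  rw [hty, min_eq_left (by linarith)] at hs
  rcases le_total b s with hbs | hsb
  · linarith [hb1 s hbs hsd]
  · exact absurd (ht3 ⟨⟨ht1.1.trans hts.le, hsb⟩, hs.le⟩) (not_le.2 hts)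

theorem exists_eq_Ioo_of_isOpen_of_isConnected {s : Set ℝ} {c d : ℝ} (ho : IsOpen s)
    (hs : IsConnected s) (hsub : s ⊆ Ioo c d) :
    ∃ a b, c ≤ a ∧ a < b ∧ b ≤ d ∧ s = Ioo a b := by
  have hbb : BddBelow s := bddBelow_Ioo.mono hsub
  have hba : BddAbove s := bddAbove_Ioo.mono hsub
  have hsub2 : s ⊆ Ioo (sInf s) (sSup s) := by
    intro x hx
    obtain ⟨l, u, ⟨h1, h2⟩, h3⟩ := (mem_nhds_iff_exists_Ioo_subset).1 (ho.mem_nhds hx)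
    obtain ⟨y, hy1, hy2⟩ := exists_between h1
    obtain ⟨z, hz1, hz2⟩ := exists_between h2
    exact ⟨(csInf_le hbb (h3 ⟨hy1, hy2.trans h2⟩)).trans_lt hy2,
      hz1.trans_le (le_csSup hba (h3 ⟨h1.trans hz1, hz2⟩))⟩
  have heq := hsub2.antisymm (hs.Ioo_csInf_csSup_subset hbb hba)
  obtain ⟨x, hx⟩ := hs.nonempty
  have hx' := hsub2 hx
  refine ⟨sInf s, sSup s, le_csInf hs.nonempty fun y hy => (hsub hy).1.le, hx'.1.trans hx'.2,
    csSup_le hs.nonempty fun y hy => (hsub hy).2.le, heq⟩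

/-- An inequality for integrals over the components of a bounded open set sums up. -/
theorem setIntegral_nonpos_of_components {E : Set ℝ} {c d : ℝ} (hE : IsOpen E)
    (hsub : E ⊆ Ioo c d) {g : ℝ → ℝ} (hg : IntegrableOn g E)
    (h : ∀ a b, c ≤ a → a < b → b ≤ d → Ioo a b ⊆ E → a ∉ E → b ∉ E → ∫ t in Ioo a b, g t ≤ 0) :
    ∫ t in E, g t ≤ 0 := by
  set S : Set (Set ℝ) := connectedComponentIn E '' E with hS
  have hSo : ∀ s ∈ S, IsOpen s := by
    rintro _ ⟨x, hx, rfl⟩; exact hE.connectedComponentIn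
  have hSd : S.PairwiseDisjoint id := by
    rintro _ ⟨x, hx, rfl⟩ _ ⟨y, hy, rfl⟩ hne
    simp only [Function.onFun, id]
    rw [Set.disjoint_left]
    intro z hz1 hz2
    exact hne ((connectedComponentIn_eq hz1).trans (connectedComponentIn_eq hz2).symm)
  have hSc : S.Countable := hSd.countable_of_isOpen hSo (by
    rintro _ ⟨x, hx, rfl⟩; exact ⟨x, mem_connectedComponentIn hx⟩)
  have hU : ⋃ s : S, (s : Set ℝ) = E := by
    refine subset_antisymm (iUnion_subset ?_) fun x hx => ?_
    · rintro ⟨_, x, hx, rfl⟩; exact connectedComponentIn_subset E x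
    · exact mem_iUnion.2 ⟨⟨_, x, hx, rfl⟩, mem_connectedComponentIn hx⟩
  have := hSc.to_subtype
  have hsum := hasSum_integral_iUnion (μ := volume) (f := g) (s := fun s : S => (s : Set ℝ))
    (fun s => (hSo s s.2).measurableSet)
    (fun s t hst => hSd s.2 t.2 (fun h => hst (Subtype.ext h))) (by rwa [hU])
  rw [hU] at hsum
  refine hasSum_le ?_ hsum hasSum_zero
  rintro ⟨_, x, hx, rfl⟩
  have hsubE := connectedComponentIn_subset E x
  obtain ⟨a, b, hca, hab, hbd, heq⟩ := exists_eq_Ioo_of_isOpen_of_isConnected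
    (hE.connectedComponentIn (x := x)) (isConnected_connectedComponentIn_iff.2 hx) (hsubE.trans hsub)
  have hxI : x ∈ Ioo a b := heq ▸ mem_connectedComponentIn hx
  have hIE : Ioo a b ⊆ E := heq ▸ hsubE
  simp only [heq]
  refine h a b hca hab hbd hIE (fun haE => ?_) (fun hbE => ?_)
  · have : Ico a b ⊆ connectedComponentIn E x :=
      isPreconnected_Ico.subset_connectedComponentIn ⟨hxI.1.le, hxI.2⟩ (by
        rw [← Ioo_insert_left hab]; exact insert_subset haE hIE)
    rw [heq] at this
    exact lt_irrefl a (this ⟨le_rfl, hab⟩).1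
  · have : Ioc a b ⊆ connectedComponentIn E x :=
      isPreconnected_Ioc.subset_connectedComponentIn ⟨hxI.1, hxI.2.le⟩ (by
        rw [← Ioo_insert_right hab]; exact insert_subset hbE hIE)
    rw [heq] at this
    exact lt_irrefl b (this ⟨hab, le_rfl⟩).2

/-! ### Sun sets of integrable functions -/

section RisingSun

variable {ψ g : ℝ → ℝ} {c d : ℝ}

/-- The rising sun set of a function `ψ` of negative mean. -/
def sunSet (ψ : ℝ → ℝ) (c d : ℝ) : Set ℝ := risingSet (fun t => ∫ s in c..t, ψ s) c d

theorem continuousOn_primitive_Icc (hψ : IntegrableOn ψ (Icc c d)) :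
    ContinuousOn (fun t => ∫ s in c..t, ψ s) (Icc c d) := by
  rcases le_or_gt c d with h | h
  · have := intervalIntegral.continuousOn_primitive_interval (μ := volume) (f := ψ) (a := c) (b := d)
      (by rwa [uIcc_of_le h])
    rwa [uIcc_of_le h] at this
  · simp [h]

theorem isOpen_sunSet (hψ : IntegrableOn ψ (Icc c d)) : IsOpen (sunSet ψ c d) :=
  isOpen_risingSet (continuousOn_primitive_Icc hψ)

theorem sunSet_subset (ψ : ℝ → ℝ) (c d : ℝ) : sunSet ψ c d ⊆ Ioo c d := risingSet_subset _ _ _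

theorem intervalIntegrable_of_integrableOn_Icc {a b : ℝ} (hψ : IntegrableOn ψ (Icc c d))
    (hca : c ≤ a) (hab : a ≤ b) (hbd : b ≤ d) : IntervalIntegrable ψ volume a b := by
  rw [intervalIntegrable_iff_integrableOn_Icc_of_le hab]
  exact hψ.mono_set (Icc_subset_Icc hca hbd)

/-- Each component of the sun set is an interval of zero `ψ`-mean, so an inequality known on such
intervals passes to the whole set by summation. -/
theorem setIntegral_sunSet_nonpos (hψ : IntegrableOn ψ (Icc c d)) (hneg : ∫ s in c..d, ψ s < 0)
    (hg : IntegrableOn g (Icc c d))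
    (h : ∀ a b, c ≤ a → a < b → b ≤ d → ∫ t in a..b, ψ t = 0 → ∫ t in a..b, g t ≤ 0) :
    ∫ t in sunSet ψ c d, g t ≤ 0 := by
  have hsub := sunSet_subset ψ c d
  refine setIntegral_nonpos_of_components (isOpen_sunSet hψ) hsub
    (hg.mono_set (hsub.trans Ioo_subset_Icc_self)) fun a b hca hab hbd hI ha hb => ?_
  have heq := eq_of_component_risingSet (continuousOn_primitive_Icc hψ) (by simp) hneg hab hca hbd
    hI ha hb
  rw [← integral_Ioc_eq_integral_Ioo, ← intervalIntegral.integral_of_le hab.le]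
  refine h a b hca hab hbd ?_
  rw [← intervalIntegral.integral_add_adjacent_intervals
    (intervalIntegrable_of_integrableOn_Icc hψ le_rfl hca (hab.le.trans hbd))
    (intervalIntegrable_of_integrableOn_Icc hψ hca hab.le hbd)] at heq
  linarith

theorem setIntegral_sunSet_self (hψ : IntegrableOn ψ (Icc c d)) (hneg : ∫ s in c..d, ψ s < 0) :
    ∫ t in sunSet ψ c d, ψ t = 0 := by
  refine le_antisymm (setIntegral_sunSet_nonpos hψ hneg hψ fun _ _ _ _ _ h => h.le) ?_
  have := setIntegral_sunSet_nonpos hψ hneg hψ.neg fun a b _ _ _ h => by simp [h]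
  simp only [Pi.neg_apply, integral_neg] at this
  linarith

/-- Off the sun set the primitive of `ψ` never rises above its present value, so its right
difference quotients are nonpositive; Lebesgue differentiation concludes. -/
theorem ae_nonpos_of_notMem_sunSet (hcd : c < d) (hψ : IntegrableOn ψ (Icc c d))
    (hneg : ∫ s in c..d, ψ s < 0) :
    ∀ᵐ t, t ∈ Ioo c d → t ∉ sunSet ψ c d → ψ t ≤ 0 := by
  filter_upwards [(intervalIntegrable_of_integrableOn_Icc hψ le_rfl hcd.le
    le_rfl).ae_hasDerivAt_integral] with t ht htI htE
  have hder := ht (by rw [uIcc_of_le hcd.le]; exact Ioo_subset_Icc_self htI) c left_mem_uIcc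
  obtain ⟨-, hle⟩ := le_of_notMem_risingSet (continuousOn_primitive_Icc hψ) hneg htI.1 htI.2.le htE
  have h2 := hder.hasDerivWithinAt (s := Ioi t)
  rw [hasDerivWithinAt_iff_tendsto_slope' (by simp)] at h2
  refine le_of_tendsto h2 ?_
  filter_upwards [Ioo_mem_nhdsGT htI.2] with s hs
  rw [slope_def_field]
  exact div_nonpos_of_nonpos_of_nonneg (by linarith [hle s hs.1.le hs.2.le]) (by linarith [hs.1])

/-- Both ways of belonging to the set, `Φ t < Φ s` and `0 < Φ s`, say that some integral of `ψ` is
positive, which persists when `ψ` increases. -/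
theorem sunSet_mono {ψ' : ℝ → ℝ} (hψ : IntegrableOn ψ (Icc c d)) (hψ' : IntegrableOn ψ' (Icc c d))
    (h : ∀ t, ψ t ≤ ψ' t) : sunSet ψ c d ⊆ sunSet ψ' c d := by
  rintro t ⟨ht, s, hts, hsd, hs⟩
  refine ⟨ht, s, hts, hsd, ?_⟩
  have hct := ht.1.le
  have hcs := hct.trans hts.le
  have i1 := intervalIntegrable_of_integrableOn_Icc hψ hct hts.le hsd
  have i1' := intervalIntegrable_of_integrableOn_Icc hψ' hct hts.le hsd
  have i2 := intervalIntegrable_of_integrableOn_Icc hψ le_rfl hct ht.2.le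
  have i2' := intervalIntegrable_of_integrableOn_Icc hψ' le_rfl hct ht.2.le
  have e := intervalIntegral.integral_add_adjacent_intervals i2 i1
  have e' := intervalIntegral.integral_add_adjacent_intervals i2' i1'
  have m1 := intervalIntegral.integral_mono hts.le i1 i1' h
  have m2 := intervalIntegral.integral_mono hct i2 i2' h
  simp only [min_lt_iff] at hs ⊢
  rcases hs with hs | hs
  · left; linarith
  · right; linarith

end RisingSun

/-! ### Monotonicity of the potential -/

/-- Over `n + 1` equal steps the quadratic errors add up to `O(1/n)`. This replaces the sign of a
derivative, as no differentiability or continuity is assumed. -/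
theorem le_of_forall_sub_le_mul_sq {g : ℝ → ℝ} {m u K : ℝ} (hmu : m ≤ u)
    (h : ∀ x y, m ≤ x → x ≤ y → y ≤ u → g y - g x ≤ K * (y - x) ^ 2) : g u ≤ g m := by
  have key : ∀ n : ℕ, g u - g m ≤ K * (u - m) ^ 2 * (1 / ((n : ℝ) + 1)) := by
    intro n
    have hn : (0 : ℝ) < (n : ℝ) + 1 := by positivity
    set δ := (u - m) / ((n : ℝ) + 1) with hδ
    have hδ0 : 0 ≤ δ := div_nonneg (by linarith) hn.le
    have hnδ : ((n : ℝ) + 1) * δ = u - m := by rw [hδ]; field_simp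
    have hk : ∀ k : ℕ, k ≤ n + 1 → g (m + k * δ) - g m ≤ k * (K * δ ^ 2) := by
      intro k
      induction k with
      | zero => intro _; simp
      | succ k ih =>
        intro hk
        have hk' : ((k : ℝ) + 1) ≤ (n : ℝ) + 1 := by exact_mod_cast hk
        have h1 := h (m + k * δ) (m + (k + 1) * δ) (by nlinarith [mul_nonneg k.cast_nonneg hδ0])
          (by nlinarith) (by nlinarith)
        have h2 := ih (by omega)
        have h3 : m + ((k : ℝ) + 1) * δ - (m + k * δ) = δ := by ring
        rw [h3] at h1
        push_cast
        linarith
    have := hk (n + 1) le_rfl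
    push_cast at this
    rw [hnδ, add_sub_cancel] at this
    refine this.trans_eq ?_
    rw [hδ]; field_simp
  have hlim : Filter.Tendsto (fun n : ℕ => K * (u - m) ^ 2 * (1 / ((n : ℝ) + 1))) Filter.atTop
      (nhds (K * (u - m) ^ 2 * 0)) := tendsto_one_div_add_atTop_nhds_zero_nat.const_mul _
  rw [mul_zero] at hlim
  linarith [ge_of_tendsto' hlim key]

theorem exp_neg_le_quadratic {x : ℝ} (hx : 0 ≤ x) : Real.exp (-x) ≤ 1 - x + x ^ 2 / 2 := by
  have h1 := Real.quadratic_le_exp_of_nonneg hx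
  have h2 : Real.exp (-x) * Real.exp x = 1 := by rw [← Real.exp_add]; simp
  have h3 : 0 < 1 - x + x ^ 2 / 2 := by nlinarith [sq_nonneg (x - 1)]
  by_contra! h
  -- The product `(1 - x + x²/2)(1 + x + x²/2)` equals `1 + x⁴/4 ≥ 1`.
  nlinarith [mul_lt_mul_of_pos_right h (Real.exp_pos x), mul_le_mul_of_nonneg_left h1 h3.le,
    pow_nonneg hx 4]

/-- Here `T` and `H` stand for `|E_α|` and `∫_{E_α} e^φ`. Hypothesis `hstep` expresses that the
integral over `E_α` of the gap between `e^φ` and its tangent at `s` shrinks with `E_α`; `hH` is the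
`A_∞` condition summed over components. -/
theorem exp_potential_le {T H : ℝ → ℝ} {ξ C m u M : ℝ} (h0 : 0 < ξ) (h1 : ξ < 1) (hC : 0 ≤ C)
    (hξ : Real.exp (-ξ) = C * (1 - ξ)) (hmu : m ≤ u)
    (hT0 : ∀ α, m ≤ α → α ≤ u → 0 ≤ T α) (hTM : ∀ α, m ≤ α → α ≤ u → T α ≤ M)
    (hH : ∀ α, m ≤ α → α ≤ u → H α ≤ C * Real.exp α * T α)
    (hstep : ∀ α' α s, m ≤ α' → α' ≤ α → α ≤ u →
      H α - Real.exp s * (1 + (α - s)) * T α ≤ H α' - Real.exp s * (1 + (α' - s)) * T α') :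
    Real.exp (u * (1 / ξ - 1)) * (H u - C * Real.exp u * (1 - ξ ^ 2) * T u) ≤
      Real.exp (m * (1 / ξ - 1)) * (H m - C * Real.exp m * (1 - ξ ^ 2) * T m) := by
  refine le_of_forall_sub_le_mul_sq
    (g := fun α => Real.exp (α * (1 / ξ - 1)) * (H α - C * Real.exp α * (1 - ξ ^ 2) * T α))
    (K := C * M * Real.exp (u / ξ) * ((1 - ξ) * (1 + ξ + (u - m)) / (2 * ξ ^ 2))) hmu ?_
  intro α' α hα' hαα hα
  have hmα : m ≤ α := hα'.trans hαα
  set β := 1 / ξ - 1 with hβ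
  have hβ0 : 0 ≤ β := by rw [hβ, sub_nonneg, le_div_iff₀ h0]; linarith
  obtain ⟨δ, rfl⟩ : ∃ δ, α = α' + δ := ⟨α - α', by ring⟩
  have hδ : 0 ≤ δ := by linarith
  -- With the tangent at `α' - ξ`, the coefficient of `T α'` is `e^{α'-ξ} (1 + ξ) = C e^{α'} (1 -
  -- ξ²)`, the one in the potential.
  have hs := hstep α' (α' + δ) (α' - ξ) hα' hαα hα
  have hT := hT0 _ hmα hα
  have hTM' := hTM _ hmα hα
  have hHα := hH _ hmα hα
  have es : Real.exp (α' - ξ) = Real.exp α' * (C * (1 - ξ)) := by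
    rw [sub_eq_add_neg, Real.exp_add, hξ]
  rw [es] at hs
  generalize H (α' + δ) = Hα at *
  generalize T (α' + δ) = Tα at *
  generalize H α' = Hα' at *
  generalize T α' = Tα' at *
  have e1 : Real.exp (α' * β) * Real.exp α' = Real.exp (α' / ξ) := by
    rw [← Real.exp_add]; congr 1; rw [hβ]; field_simp; ring
  have e2 : Real.exp ((α' + δ) * β) * Real.exp (α' + δ) = Real.exp ((α' + δ) / ξ) := by
    rw [← Real.exp_add]; congr 1; rw [hβ]; field_simp; ring
  have e3 : Real.exp (α' / ξ) = Real.exp ((α' + δ) / ξ) * Real.exp (-(δ / ξ)) := by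
    rw [← Real.exp_add]; congr 1; field_simp; ring
  have e4 : Real.exp (α' * β) = Real.exp ((α' + δ) * β) * Real.exp (-(δ * β)) := by
    rw [← Real.exp_add]; congr 1; ring
  have b1 : 1 - Real.exp (-(δ * β)) ≤ δ * β := by linarith [Real.add_one_le_exp (-(δ * β))]
  have b1' : 0 ≤ 1 - Real.exp (-(δ * β)) := by
    rw [sub_nonneg, Real.exp_le_one_iff]; linarith [mul_nonneg hδ hβ0]
  have b2 := exp_neg_le_quadratic (div_nonneg hδ h0.le)
  have eξ : ξ ^ 2 > 0 := by positivity
  set P := Real.exp ((α' + δ) / ξ) with hP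
  have hP0 : 0 < P := Real.exp_pos _
  set E := Real.exp (-(δ / ξ))
  set F := Real.exp (-(δ * β))
  set Q := Real.exp ((α' + δ) * β)
  have hQ0 : 0 < Q := Real.exp_pos _
  have hlow : Q * F * Hα - C * (1 - ξ) * (1 + ξ + δ) * (P * E) * Tα ≤
      Real.exp (α' * β) * (Hα' - C * Real.exp α' * (1 - ξ ^ 2) * Tα') := by
    have h5 := mul_le_mul_of_nonneg_left hs (Real.exp_pos (α' * β)).le
    rw [← e3, ← e1, ← e4]
    refine le_trans (le_of_eq ?_) (h5.trans (le_of_eq ?_)) <;> ring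
  have hup : Q * (1 - F) * Hα ≤ C * P * Tα * (1 - F) := by
    rw [← e2]
    have := mul_le_mul_of_nonneg_left hHα (mul_nonneg hQ0.le b1')
    linarith
  have hdiff : Q * (Hα - C * Real.exp (α' + δ) * (1 - ξ ^ 2) * Tα) =
      Q * Hα - C * P * (1 - ξ ^ 2) * Tα := by rw [← e2]; ring
  -- The zeroth and first order terms in `δ` cancel; the first order ones do so because of the
  -- exponent `β = 1/ξ - 1`.
  have hbr : (1 - F) - (1 - ξ ^ 2) + (1 - ξ) * (1 + ξ + δ) * E ≤
      (1 - ξ) * (1 + ξ + (u - m)) / (2 * ξ ^ 2) * δ ^ 2 := by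
    have c1 : (1 - ξ) * (1 + ξ + δ) * E ≤
        (1 - ξ) * (1 + ξ + δ) * (1 - δ / ξ + (δ / ξ) ^ 2 / 2) :=
      mul_le_mul_of_nonneg_left b2 (mul_nonneg (by linarith) (by linarith))
    have c2 : δ * β - (1 - ξ ^ 2) + (1 - ξ) * (1 + ξ + δ) * (1 - δ / ξ + (δ / ξ) ^ 2 / 2) =
        (1 - ξ) * (1 + ξ + δ) / (2 * ξ ^ 2) * δ ^ 2 - (1 - ξ) * δ ^ 2 / ξ := by
      rw [hβ]; field_simp; ring
    have c3 : 0 ≤ (1 - ξ) * δ ^ 2 / ξ :=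
      div_nonneg (mul_nonneg (by linarith) (sq_nonneg _)) h0.le
    have c4 : (1 - ξ) * (1 + ξ + δ) / (2 * ξ ^ 2) * δ ^ 2 ≤
        (1 - ξ) * (1 + ξ + (u - m)) / (2 * ξ ^ 2) * δ ^ 2 := by
      have : δ ≤ u - m := by linarith
      have : 0 ≤ 1 - ξ := by linarith
      gcongr
    linarith
  have hfin : C * P * Tα * ((1 - ξ) * (1 + ξ + (u - m)) / (2 * ξ ^ 2) * δ ^ 2) ≤
      C * Real.exp (u / ξ) * M * ((1 - ξ) * (1 + ξ + (u - m)) / (2 * ξ ^ 2) * δ ^ 2) := by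
    have : 0 ≤ 1 - ξ := by linarith
    have : 0 ≤ u - m := by linarith
    have : P ≤ Real.exp (u / ξ) := Real.exp_le_exp.2 (by gcongr)
    gcongr
  have hmul := mul_le_mul_of_nonneg_left hbr (mul_nonneg (mul_nonneg hC hP0.le) hT)
  rw [hdiff, add_sub_cancel_left]
  linarith

/-! ### Chebyshev's inequality for the tangent gap -/

/-- The distance of the exponential function from its tangent line at `s`. -/
noncomputable def tangentGap (s r : ℝ) : ℝ := Real.exp r - Real.exp s * (1 + (r - s))

theorem tangentGap_nonneg (s r : ℝ) : 0 ≤ tangentGap s r := by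
  have h1 := Real.add_one_le_exp (r - s)
  have h2 : Real.exp r = Real.exp s * Real.exp (r - s) := by rw [← Real.exp_add]; congr 1; ring
  rw [tangentGap, h2]
  nlinarith [Real.exp_pos s]

theorem tangentGap_pos {s r : ℝ} (h : s < r) : 0 < tangentGap s r := by
  have h1 := Real.add_one_lt_exp (x := r - s) (by linarith)
  have h2 : Real.exp r = Real.exp s * Real.exp (r - s) := by rw [← Real.exp_add]; congr 1; ring
  rw [tangentGap, h2]
  nlinarith [Real.exp_pos s]

theorem tangentGap_mono {s r r' : ℝ} (hs : s ≤ r) (hr : r ≤ r') :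
    tangentGap s r ≤ tangentGap s r' := by
  have h1 := tangentGap_nonneg r r'
  have h2 : Real.exp s ≤ Real.exp r := Real.exp_le_exp.2 hs
  simp only [tangentGap] at *
  nlinarith

section Distribution

variable {φ : ℝ → ℝ} {c d : ℝ}

theorem integrableOn_tangentGap {E : Set ℝ} (hEm : volume E ≠ ∞) (s : ℝ) (hφ : IntegrableOn φ E)
    (he : IntegrableOn (fun t => Real.exp (φ t)) E) :
    IntegrableOn (fun t => tangentGap s (φ t)) E := by
  have hc : ∀ x : ℝ, IntegrableOn (fun _ => x) E := fun x => integrableOn_const hEm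
  exact he.sub (((hc 1).add (hφ.sub (hc s))).const_mul _)

theorem setIntegral_tangentGap {E : Set ℝ} (hEm : volume E ≠ ∞) (s : ℝ) (hφ : IntegrableOn φ E)
    (he : IntegrableOn (fun t => Real.exp (φ t)) E) :
    ∫ t in E, tangentGap s (φ t) = (∫ t in E, Real.exp (φ t)) -
      Real.exp s * (volume.real E + (∫ t in E, φ t) - s * volume.real E) := by
  have hc : ∀ x : ℝ, IntegrableOn (fun _ => x) E := fun x => integrableOn_const hEm
  have h1 : IntegrableOn (fun t => φ t - s) E := hφ.sub (hc s)
  have h2 : IntegrableOn (fun t => 1 + (φ t - s)) E := (hc 1).add h1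
  simp only [tangentGap]
  rw [integral_sub he (h2.const_mul _), integral_const_mul, integral_add (hc 1) h1,
    integral_sub hφ (hc s)]
  simp only [integral_const, measureReal_restrict_apply_univ, smul_eq_mul]
  ring

/-- Chebyshev's inequality: the gap is nonnegative everywhere and increasing to the right of `s`. -/
theorem measureReal_mul_tangentGap_le {E : Set ℝ} (hEm : volume E ≠ ∞)
    (hφ : IntegrableOn φ E) (he : IntegrableOn (fun t => Real.exp (φ t)) E) {s Lam : ℝ}
    (hs : s < Lam) :
    tangentGap s Lam * (volume.restrict E).real {t | Lam ≤ φ t} ≤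
      ∫ t in E, tangentGap s (φ t) := by
  have : IsFiniteMeasure (volume.restrict E) := ⟨by simpa using hEm.lt_top⟩
  refine le_trans ?_ (mul_meas_ge_le_integral_of_nonneg
    (Filter.Eventually.of_forall fun t => tangentGap_nonneg s (φ t))
    (integrableOn_tangentGap hEm s hφ he) (tangentGap s Lam))
  refine mul_le_mul_of_nonneg_left (measureReal_mono fun t ht => ?_) (tangentGap_nonneg _ _)
  exact tangentGap_mono hs.le ht

theorem tangentGap_chord {C ξ η u : ℝ} (hξ : Real.exp (-ξ) = C * (1 - ξ))
    (hη : Real.exp (-η) = C * (1 - η)) :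
    tangentGap (u - ξ) (u - η) = C * Real.exp u * (ξ * (ξ - η)) := by
  have e1 : Real.exp (u - ξ) = Real.exp u * (C * (1 - ξ)) := by
    rw [sub_eq_add_neg, Real.exp_add, hξ]
  have e2 : Real.exp (u - η) = Real.exp u * (C * (1 - η)) := by
    rw [sub_eq_add_neg, Real.exp_add, hη]
  rw [tangentGap, e1, e2]; ring

/-- The tangency point `u - ξ` and the level `u - η` are the ends of the chord cut from `e^r` by the
tangent to `C e^r` at the mean `u`, which makes all constants explicit. -/
theorem measureReal_chord_le {C ξ η u : ℝ} (hξη : η < ξ) (hξ : Real.exp (-ξ) = C * (1 - ξ))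
    (hη : Real.exp (-η) = C * (1 - η)) {E : Set ℝ} (hEm : volume E ≠ ∞)
    (hφ : IntegrableOn φ E) (he : IntegrableOn (fun t => Real.exp (φ t)) E)
    (hmean : ∫ t in E, φ t = u * volume.real E) :
    C * Real.exp u * (ξ * (ξ - η)) * (volume.restrict E).real {t | u - η ≤ φ t} ≤
      (∫ t in E, Real.exp (φ t)) - C * Real.exp u * (1 - ξ ^ 2) * volume.real E := by
  have h := measureReal_mul_tangentGap_le hEm hφ he (s := u - ξ) (Lam := u - η) (by linarith)
  have e1 : Real.exp (u - ξ) = Real.exp u * (C * (1 - ξ)) := by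
    rw [sub_eq_add_neg, Real.exp_add, hξ]
  rw [tangentGap_chord hξ hη, setIntegral_tangentGap hEm _ hφ he, hmean, e1] at h
  refine h.trans_eq ?_
  ring

end Distribution

/-! ### The two regimes of the distribution estimate -/

section UpperBound

variable {φ : ℝ → ℝ} {c d C : ℝ}

theorem setIntegral_exp_sunSet_le {ψ : ℝ → ℝ} {α : ℝ} (hψ : IntegrableOn ψ (Icc c d))
    (hneg : ∫ s in c..d, ψ s < 0)
    (he : IntegrableOn (fun t => Real.exp (φ t)) (Icc c d))
    (hA : ∀ a b, c ≤ a → a < b → b ≤ d →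
      ∫ t in a..b, Real.exp (φ t) ≤ C * Real.exp ((∫ t in a..b, φ t) / (b - a)) * (b - a))
    (hψφ : ∀ a b, c ≤ a → a < b → b ≤ d → ∫ t in a..b, ψ t = 0 → ∫ t in a..b, φ t = α * (b - a)) :
    ∫ t in sunSet ψ c d, Real.exp (φ t) ≤ C * Real.exp α * volume.real (sunSet ψ c d) := by
  have hc : IntegrableOn (fun _ => C * Real.exp α) (Icc c d) := integrableOn_const (by simp)
  have h := setIntegral_sunSet_nonpos hψ hneg (he.sub hc) (fun a b hca hab hbd h0 => by
    have h1 := hA a b hca hab hbd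
    rw [hψφ a b hca hab hbd h0, mul_div_cancel_right₀ _ (by linarith : b - a ≠ 0)] at h1
    have h2 := intervalIntegral.integral_sub
      (intervalIntegrable_of_integrableOn_Icc he hca hab.le hbd)
      (intervalIntegrable_of_integrableOn_Icc hc hca hab.le hbd)
    simp only [Pi.sub_apply]
    rw [h2, intervalIntegral.integral_const, smul_eq_mul]
    linarith)
  have hsub := (sunSet_subset ψ c d).trans Ioo_subset_Icc_self
  simp only [Pi.sub_apply] at h
  rw [integral_sub (he.mono_set hsub) (hc.mono_set hsub)] at h
  simp only [integral_const, measureReal_restrict_apply_univ, smul_eq_mul] at h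
  linarith

theorem volume_ne_top_of_subset_Icc {E : Set ℝ} (hE : E ⊆ Icc c d) : volume E ≠ ∞ :=
  measure_ne_top_of_subset hE (by simp)

theorem intervalIntegral_sub_const {a b α : ℝ} (hφ : IntervalIntegrable φ volume a b) :
    ∫ t in a..b, (φ t - α) = (∫ t in a..b, φ t) - α * (b - a) := by
  rw [intervalIntegral.integral_sub hφ intervalIntegrable_const, intervalIntegral.integral_const,
    smul_eq_mul]
  ring

theorem intervalIntegral_const_sub {a b α : ℝ} (hφ : IntervalIntegrable φ volume a b) :
    ∫ t in a..b, (α - φ t) = α * (b - a) - ∫ t in a..b, φ t := by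
  rw [intervalIntegral.integral_sub intervalIntegrable_const hφ, intervalIntegral.integral_const,
    smul_eq_mul]
  ring

theorem setIntegral_sub_const {E : Set ℝ} {α : ℝ} (hE : volume E ≠ ∞) (hφ : IntegrableOn φ E) :
    ∫ t in E, (φ t - α) = (∫ t in E, φ t) - α * volume.real E := by
  rw [integral_sub hφ (integrableOn_const hE)]
  simp only [integral_const, measureReal_restrict_apply_univ, smul_eq_mul]
  ring

/-- The exponential part of the distribution estimate. -/
theorem measureReal_le_exp_of_mean_lt {ξ η m u : ℝ} (hcd : c < d) (hC : 0 < C) (h0 : 0 < ξ)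
    (h1 : ξ < 1) (hη0 : η < 0) (hξ : Real.exp (-ξ) = C * (1 - ξ)) (hη : Real.exp (-η) = C * (1 - η))
    (hφ : IntegrableOn φ (Icc c d)) (he : IntegrableOn (fun t => Real.exp (φ t)) (Icc c d))
    (hA : ∀ a b, c ≤ a → a < b → b ≤ d →
      ∫ t in a..b, Real.exp (φ t) ≤ C * Real.exp ((∫ t in a..b, φ t) / (b - a)) * (b - a))
    (hm : ∫ t in c..d, φ t = m * (d - c)) (hmu : m < u) :
    (volume.restrict (Icc c d)).real {t | u - η ≤ φ t} ≤
      ξ / (ξ - η) * Real.exp ((m - u) / ξ) * (d - c) := by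
  have hc : ∀ x : ℝ, IntegrableOn (fun _ => x) (Icc c d) := fun x => integrableOn_const (by simp)
  have hψ : ∀ α, IntegrableOn (fun t => φ t - α) (Icc c d) := fun α => hφ.sub (hc α)
  have hI := fun a b (h1 : c ≤ a) (h2 : a ≤ b) (h3 : b ≤ d) =>
    intervalIntegrable_of_integrableOn_Icc hφ h1 h2 h3
  have hneg : ∀ α, m < α → ∫ t in c..d, (φ t - α) < 0 := by
    intro α hα
    rw [intervalIntegral_sub_const (hI c d le_rfl hcd.le le_rfl), hm]
    nlinarith
  -- The rising sun lemma needs `φ - α` of negative mean, that is `α > m`; at `α = m` the whole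
  -- interval itself has mean `α`.
  set E : ℝ → Set ℝ := fun α => if α ≤ m then Icc c d else sunSet (fun t => φ t - α) c d with hE
  have hEm : E m = Icc c d := if_pos le_rfl
  have hEα : ∀ α, m < α → E α = sunSet (fun t => φ t - α) c d := fun α h => if_neg (not_le.2 h)
  have hEsub : ∀ α, E α ⊆ Icc c d := by
    intro α
    simp only [hE]
    split_ifs
    · exact subset_rfl
    · exact (sunSet_subset _ _ _).trans Ioo_subset_Icc_self
  have hEmeas : ∀ α, MeasurableSet (E α) := by
    intro α
    simp only [hE]
    split_ifs
    · exact measurableSet_Icc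
    · exact (isOpen_sunSet (hψ α)).measurableSet
  have hEtop : ∀ α, volume (E α) ≠ ∞ := fun α => volume_ne_top_of_subset_Icc (hEsub α)
  have hφE : ∀ α, IntegrableOn φ (E α) := fun α => hφ.mono_set (hEsub α)
  have heE : ∀ α, IntegrableOn (fun t => Real.exp (φ t)) (E α) := fun α => he.mono_set (hEsub α)
  have hvol : volume.real (Icc c d) = d - c := by simp [hcd.le]
  have hmean : ∀ α, m ≤ α → ∫ t in E α, φ t = α * volume.real (E α) := by
    intro α hα
    rcases hα.eq_or_lt with rfl | hα
    · rw [hEm, hvol, integral_Icc_eq_integral_Ioc, ← intervalIntegral.integral_of_le hcd.le, hm]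
    · have := setIntegral_sunSet_self (hψ α) (hneg α hα)
      rw [← hEα α hα, setIntegral_sub_const (hEtop α) (hφE α)] at this
      linarith
  have hH : ∀ α, m ≤ α →
      ∫ t in E α, Real.exp (φ t) ≤ C * Real.exp α * volume.real (E α) := by
    intro α hα
    rcases hα.eq_or_lt with rfl | hα
    · have := hA c d le_rfl hcd le_rfl
      rw [hm, mul_div_cancel_right₀ _ (by linarith : d - c ≠ 0)] at this
      rwa [hEm, hvol, integral_Icc_eq_integral_Ioc, ← intervalIntegral.integral_of_le hcd.le]
    · rw [hEα α hα]
      refine setIntegral_exp_sunSet_le (hψ α) (hneg α hα) he hA fun a b hca hab hbd h => ?_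
      rw [intervalIntegral_sub_const (hI a b hca hab.le hbd)] at h
      linarith
  have hanti : ∀ α' α, m ≤ α' → α' ≤ α → E α ⊆ E α' := by
    intro α' α h1 h2
    rcases h1.eq_or_lt with rfl | h1
    · rw [hEm]; exact hEsub α
    · rw [hEα α' h1, hEα α (h1.trans_le h2)]
      exact sunSet_mono (hψ α) (hψ α') fun t => by linarith
  have hpot := exp_potential_le (T := fun α => volume.real (E α))
    (H := fun α => ∫ t in E α, Real.exp (φ t)) (M := d - c) h0 h1 hC.le hξ hmu.le
    (fun _ _ _ => measureReal_nonneg)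
    (fun α _ _ => hvol ▸ measureReal_mono (hEsub α) (by simp))
    (fun α hα _ => hH α hα) (by
      intro α' α s h1 h2 h3
      have hmono : ∫ t in E α, tangentGap s (φ t) ≤ ∫ t in E α', tangentGap s (φ t) :=
        setIntegral_mono_set (integrableOn_tangentGap (hEtop α') s (hφE α') (heE α'))
          (Filter.Eventually.of_forall fun t => tangentGap_nonneg s (φ t))
          (LE.le.eventuallyLE (hanti α' α h1 h2))
      rw [setIntegral_tangentGap (hEtop α) s (hφE α) (heE α),
        setIntegral_tangentGap (hEtop α') s (hφE α') (heE α'), hmean α (h1.trans h2),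
        hmean α' h1] at hmono
      refine le_trans (le_of_eq ?_) (hmono.trans (le_of_eq ?_)) <;> ring)
  have hchord := measureReal_chord_le (by linarith : η < ξ) hξ hη (hEtop u) (hφE u) (heE u)
    (hmean u hmu.le)
  -- No mass of the level set is lost: off `E u`, almost everywhere `φ ≤ u < u - η`.
  have hmem : (volume.restrict (Icc c d)).real {t | u - η ≤ φ t} ≤
      (volume.restrict (E u)).real {t | u - η ≤ φ t} := by
    rw [Measure.real, Measure.real, Measure.restrict_apply' measurableSet_Icc,
      Measure.restrict_apply' (hEmeas u)]
    refine ENNReal.toReal_mono (measure_ne_top_of_subset inter_subset_right (hEtop u))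
      (measure_mono_ae ?_)
    filter_upwards [ae_nonpos_of_notMem_sunSet hcd (hψ u) (hneg u hmu),
      Ioo_ae_eq_Icc (μ := volume) (a := c) (b := d) |>.mem_iff] with t ht htI hmem
    refine ⟨hmem.1, ?_⟩
    rw [hEα u hmu]
    by_contra hn
    have h3 := ht (htI.2 hmem.2) hn
    have h4 : u - η ≤ φ t := hmem.1
    linarith
  have hHm := hH m le_rfl
  rw [hEm, hvol] at hHm
  simp only [hEm, hvol] at hpot
  generalize (∫ t in Icc c d, Real.exp (φ t)) = Hm at *
  generalize (volume.restrict (E u)).real {t | u - η ≤ φ t} = Pu at *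
  have e1 : ∀ x : ℝ, Real.exp (x * (1 / ξ - 1)) * Real.exp x = Real.exp (x / ξ) := by
    intro x; rw [← Real.exp_add]; congr 1; field_simp; ring
  -- At `m` the potential is at most `C e^{m/ξ} ξ² (d - c)`, by the `A_∞` condition on the whole
  -- interval.
  have k1 : C * Real.exp (u / ξ) * (ξ * (ξ - η)) * Pu ≤
      C * Real.exp (m / ξ) * ξ ^ 2 * (d - c) := by
    have k2 := mul_le_mul_of_nonneg_left hchord (Real.exp_pos (u * (1 / ξ - 1))).le
    have k3 := mul_le_mul_of_nonneg_left hHm (Real.exp_pos (m * (1 / ξ - 1))).le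
    rw [← e1 u, ← e1 m]
    linarith
  have e2 : Real.exp ((m - u) / ξ) * Real.exp (u / ξ) = Real.exp (m / ξ) := by
    rw [← Real.exp_add]; congr 1; field_simp; ring
  have hL : 0 < ξ - η := by linarith
  refine hmem.trans ?_
  have hpos : 0 < C * Real.exp (u / ξ) * ξ := mul_pos (mul_pos hC (Real.exp_pos _)) h0
  rw [div_mul_eq_mul_div, div_mul_eq_mul_div, le_div_iff₀ hL]
  refine le_of_mul_le_mul_left ?_ hpos
  rw [← e2] at k1
  linarith

/-- The linear part of the distribution estimate. -/
theorem measureReal_le_of_le_mean {ξ η m u : ℝ} (hcd : c < d) (hC : 0 < C) (h0 : 0 < ξ)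
    (hη0 : η ≤ 0) (hξ : Real.exp (-ξ) = C * (1 - ξ)) (hη : Real.exp (-η) = C * (1 - η))
    (hφ : IntegrableOn φ (Icc c d)) (he : IntegrableOn (fun t => Real.exp (φ t)) (Icc c d))
    (hA : ∀ a b, c ≤ a → a < b → b ≤ d →
      ∫ t in a..b, Real.exp (φ t) ≤ C * Real.exp ((∫ t in a..b, φ t) / (b - a)) * (b - a))
    (hm : ∫ t in c..d, φ t = m * (d - c)) (hum : u ≤ m) :
    (volume.restrict (Icc c d)).real {t | u - η ≤ φ t} ≤ (m - u + ξ) / (ξ - η) * (d - c) := by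
  have hL : 0 < ξ - η := by linarith
  have hvol : volume.real (Icc c d) = d - c := by simp [hcd.le]
  have key : ∀ E ⊆ Icc c d, ∫ t in E, φ t = u * volume.real E →
      ∫ t in E, Real.exp (φ t) ≤ C * Real.exp u * volume.real E →
      (volume.restrict E).real {t | u - η ≤ φ t} * (ξ - η) ≤ ξ * volume.real E := by
    intro E hE h1 h2
    have h3 := measureReal_chord_le (by linarith : η < ξ) hξ hη (volume_ne_top_of_subset_Icc hE)
      (hφ.mono_set hE) (he.mono_set hE) h1
    have hpos : 0 < C * Real.exp u * ξ := mul_pos (mul_pos hC (Real.exp_pos _)) h0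
    refine le_of_mul_le_mul_left ?_ hpos
    linarith
  have hmI : ∫ t in Icc c d, φ t = m * (d - c) := by
    rw [integral_Icc_eq_integral_Ioc, ← intervalIntegral.integral_of_le hcd.le, hm]
  rw [div_mul_eq_mul_div, le_div_iff₀ hL]
  rcases hum.eq_or_lt with rfl | hum
  · have h1 := hA c d le_rfl hcd le_rfl
    rw [hm, mul_div_cancel_right₀ _ (by linarith : d - c ≠ 0),
      intervalIntegral.integral_of_le hcd.le, ← integral_Icc_eq_integral_Ioc] at h1
    have h2 := key (Icc c d) subset_rfl (by rw [hmI, hvol]) (by rwa [hvol])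
    rw [hvol] at h2
    linarith
  have hI := fun a b (h1 : c ≤ a) (h2 : a ≤ b) (h3 : b ≤ d) =>
    intervalIntegrable_of_integrableOn_Icc hφ h1 h2 h3
  have hc : ∀ x : ℝ, IntegrableOn (fun _ => x) (Icc c d) := fun x => integrableOn_const (by simp)
  have hψ : IntegrableOn (fun t => u - φ t) (Icc c d) := (hc u).sub hφ
  have hneg : ∫ t in c..d, (u - φ t) < 0 := by
    rw [intervalIntegral_const_sub (hI c d le_rfl hcd.le le_rfl), hm]
    nlinarith
  -- Since `u < m`, the rising sun lemma is applied to `u - φ`: components again have mean `u`, but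
  -- now `φ ≥ u` a.e. off `G`.
  set G := sunSet (fun t => u - φ t) c d with hG
  have hGm : MeasurableSet G := (isOpen_sunSet hψ).measurableSet
  have hGsub : G ⊆ Icc c d := (sunSet_subset _ _ _).trans Ioo_subset_Icc_self
  have hGtop := volume_ne_top_of_subset_Icc hGsub
  have hGmean : ∫ t in G, φ t = u * volume.real G := by
    have h1 := setIntegral_sunSet_self hψ hneg
    rw [← hG, integral_sub ((hc u).mono_set hGsub) (hφ.mono_set hGsub)] at h1
    simp only [integral_const, measureReal_restrict_apply_univ, smul_eq_mul] at h1
    linarith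
  have hGexp := setIntegral_exp_sunSet_le (α := u) hψ hneg he hA fun a b hca hab hbd h => by
    rw [intervalIntegral_const_sub (hI a b hca hab.le hbd)] at h
    linarith
  have k1 := key G hGsub hGmean hGexp
  set R := Icc c d \ G with hR
  have hRsub : R ⊆ Icc c d := sdiff_subset
  have hRtop := volume_ne_top_of_subset_Icc hRsub
  have hRm : MeasurableSet R := measurableSet_Icc.diff hGm
  have hvolR : volume.real R = d - c - volume.real G := by
    rw [← hvol]; exact measureReal_sdiff hGsub hGm (by simp)
  have hRint : ∫ t in R, φ t = m * (d - c) - u * volume.real G := by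
    rw [setIntegral_sdiff hGm hφ hGsub, hmI, hGmean]
  have hRφ : ∀ᵐ t ∂(volume.restrict R), 0 ≤ φ t - (u - ξ) := by
    rw [ae_restrict_iff' hRm]
    filter_upwards [ae_nonpos_of_notMem_sunSet hcd hψ hneg,
      Ioo_ae_eq_Icc (μ := volume) (a := c) (b := d) |>.mem_iff] with t ht htI hmem
    have := ht (htI.2 hmem.1) hmem.2
    linarith
  have hRi : IntegrableOn (fun t => φ t - (u - ξ)) R :=
    (hφ.mono_set hRsub).sub (integrableOn_const hRtop)
  -- The shift `u - ξ` gives the same constant `ξ - η` as on `G`, so the two bounds add without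
  -- loss.
  have k2 := mul_meas_ge_le_integral_of_nonneg hRφ hRi (ξ - η)
  rw [setIntegral_sub_const hRtop (hφ.mono_set hRsub), hRint, hvolR] at k2
  have hset : {t | ξ - η ≤ φ t - (u - ξ)} = {t | u - η ≤ φ t} := by
    ext t; simp only [mem_ofPred_eq]; constructor <;> intro <;> linarith
  rw [hset] at k2
  have hsplit : (volume.restrict (Icc c d)).real {t | u - η ≤ φ t} =
      (volume.restrict G).real {t | u - η ≤ φ t} + (volume.restrict R).real {t | u - η ≤ φ t} := by
    have hru : volume.restrict (Icc c d) = volume.restrict G + volume.restrict R := by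
      rw [← Measure.restrict_union disjoint_sdiff_right hRm, union_sdiff_cancel hGsub]
    rw [hru, Measure.real, Measure.add_apply, ENNReal.toReal_add]
    · rfl
    · rw [Measure.restrict_apply' hGm]; exact measure_ne_top_of_subset inter_subset_right hGtop
    · rw [Measure.restrict_apply' hRm]; exact measure_ne_top_of_subset inter_subset_right hRtop
  rw [hsplit]
  linarith

/-- With `C = 1` the tangent gap at the mean `m` has nonpositive integral, while it is bounded below
by a positive number on the level set. -/
theorem measureReal_eq_zero_of_constant_one {m Lam : ℝ} (hcd : c < d)
    (hφ : IntegrableOn φ (Icc c d)) (he : IntegrableOn (fun t => Real.exp (φ t)) (Icc c d))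
    (hA : ∫ t in c..d, Real.exp (φ t) ≤ Real.exp m * (d - c))
    (hm : ∫ t in c..d, φ t = m * (d - c)) (hLam : m < Lam) :
    (volume.restrict (Icc c d)).real {t | Lam ≤ φ t} = 0 := by
  have htop : volume (Icc c d) ≠ ∞ := by simp
  have h := measureReal_mul_tangentGap_le htop hφ he hLam
  have hvol : volume.real (Icc c d) = d - c := by simp [hcd.le]
  rw [setIntegral_tangentGap htop m hφ he, hvol, integral_Icc_eq_integral_Ioc,
    integral_Icc_eq_integral_Ioc, ← intervalIntegral.integral_of_le hcd.le,
    ← intervalIntegral.integral_of_le hcd.le, hm] at h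
  have hpos := tangentGap_pos hLam
  refine le_antisymm ?_ measureReal_nonneg
  nlinarith

end UpperBound

/-! ### Passage to the `A_∞` class and the upper bound -/

theorem setAverage_Icc_eq {f : ℝ → ℝ} {c d : ℝ} (hcd : c ≤ d) :
    ⨍ t in Icc c d, f t = (∫ t in c..d, f t) / (d - c) := by
  rw [setAverage_eq, integral_Icc_eq_integral_Ioc, ← intervalIntegral.integral_of_le hcd,
    smul_eq_mul, Real.volume_real_Icc_of_le hcd, div_eq_inv_mul]

theorem average_mul_exp_le_iff {φ : ℝ → ℝ} {c d C : ℝ} (hcd : c < d) :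
    (⨍ t in Icc c d, Real.exp (φ t)) * Real.exp (-(⨍ t in Icc c d, φ t)) ≤ C ↔
      ∫ t in c..d, Real.exp (φ t) ≤ C * Real.exp ((∫ t in c..d, φ t) / (d - c)) * (d - c) := by
  rw [setAverage_Icc_eq hcd.le, setAverage_Icc_eq hcd.le, Real.exp_neg, ← div_eq_mul_inv,
    div_le_iff₀ (Real.exp_pos _), div_le_iff₀ (by linarith)]

theorem integrableOn_of_exp_mem_AInftyLE {φ : ℝ → ℝ} {C a b : ℝ}
    (h : (fun t => Real.exp (φ t)) ∈ AInftyLE C a b) :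
    IntegrableOn φ (Icc a b) ∧ IntegrableOn (fun t => Real.exp (φ t)) (Icc a b) := by
  refine ⟨?_, h.1.1.integrable⟩
  have := h.1.1.integrable_log
  simpa using this

theorem integral_exp_le_of_mem_AInftyLE {φ : ℝ → ℝ} {C a b c d : ℝ} (hC : 0 ≤ C)
    (h : (fun t => Real.exp (φ t)) ∈ AInftyLE C a b) (hac : a ≤ c) (hcd : c < d) (hdb : d ≤ b) :
    ∫ t in c..d, Real.exp (φ t) ≤ C * Real.exp ((∫ t in c..d, φ t) / (d - c)) * (d - c) := by
  rw [← average_mul_exp_le_iff hcd, ← ENNReal.ofReal_le_ofReal_iff hC]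
  have h1 := h.2
  simp only [aInftyChar, iSup_le_iff, Real.log_exp] at h1
  exact h1 c d hac hcd hdb

theorem exp_mem_AInftyLE {φ : ℝ → ℝ} {C a b : ℝ} (hφ : IntegrableOn φ (Icc a b))
    (he : IntegrableOn (fun t => Real.exp (φ t)) (Icc a b))
    (hA : ∀ c d, a ≤ c → c < d → d ≤ b →
      ∫ t in c..d, Real.exp (φ t) ≤ C * Real.exp ((∫ t in c..d, φ t) / (d - c)) * (d - c)) :
    (fun t => Real.exp (φ t)) ∈ AInftyLE C a b := by
  have hle : aInftyChar (fun t => Real.exp (φ t)) a b ≤ ENNReal.ofReal C := by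
    simp only [aInftyChar, iSup_le_iff, Real.log_exp]
    exact fun c d hac hcd hdb =>
      ENNReal.ofReal_le_ofReal ((average_mul_exp_le_iff hcd).2 (hA c d hac hcd hdb))
  refine ⟨⟨⟨Filter.Eventually.of_forall fun t => Real.exp_pos _, he, ?_⟩,
    hle.trans_lt ENNReal.ofReal_lt_top⟩, hle⟩
  simpa using hφ

theorem xiPlus_pos {C : ℝ} (hC : 1 < C) : 0 < xiPlus C := by
  obtain ⟨h0, -, h⟩ := xiPlus_spec hC.le
  refine lt_of_le_of_ne h0 fun h1 => ?_
  rw [← h1] at h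
  simp at h
  linarith

theorem xiMinus_neg {C : ℝ} (hC : 1 < C) : xiMinus C < 0 := by
  obtain ⟨h0, h⟩ := xiMinus_spec hC.le
  refine lt_of_le_of_ne h0 fun h1 => ?_
  rw [h1] at h
  simp at h
  linarith

theorem upperProportion_eq {φ : ℝ → ℝ} {c d m lam : ℝ} (hcd : c < d)
    (hm : ∫ t in c..d, φ t = m * (d - c)) :
    upperProportion φ c d lam = (volume.restrict (Icc c d)).real {t | m + lam ≤ φ t} / (d - c) := by
  rw [upperProportion, setAverage_Icc_eq hcd.le, hm, mul_div_cancel_right₀ _ (by linarith),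
    Measure.real, Measure.restrict_apply' measurableSet_Icc]
  congr 3
  ext t
  simp only [mem_ofPred_eq, mem_inter_iff]
  rw [and_comm, le_sub_iff_add_le']

theorem upperProportion_le_one {φ : ℝ → ℝ} {c d lam : ℝ} (hcd : c < d) :
    upperProportion φ c d lam ≤ 1 := by
  rw [upperProportion, div_le_one (by linarith), ← Real.volume_real_Icc_of_le hcd.le]
  exact measureReal_mono (fun t ht => ht.1) (by simp)

theorem upperProportion_le_distBound {φ : ℝ → ℝ} {C a b c d lam : ℝ} (hC : 1 ≤ C)
    (h : (fun t => Real.exp (φ t)) ∈ AInftyLE C a b) (hac : a ≤ c) (hcd : c < d) (hdb : d ≤ b) :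
    upperProportion φ c d lam ≤ distBound C lam := by
  have hC0 : 0 < C := by linarith
  have hsub : Icc c d ⊆ Icc a b := Icc_subset_Icc hac hdb
  have hφ := (integrableOn_of_exp_mem_AInftyLE h).1.mono_set hsub
  have he := (integrableOn_of_exp_mem_AInftyLE h).2.mono_set hsub
  have hA : ∀ x y, c ≤ x → x < y → y ≤ d → ∫ t in x..y, Real.exp (φ t) ≤
      C * Real.exp ((∫ t in x..y, φ t) / (y - x)) * (y - x) := fun x y hx hxy hy =>
    integral_exp_le_of_mem_AInftyLE hC0.le h (hac.trans hx) hxy (hy.trans hdb)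
  have hl : 0 < d - c := by linarith
  obtain ⟨m, hm⟩ : ∃ m, ∫ t in c..d, φ t = m * (d - c) :=
    ⟨(∫ t in c..d, φ t) / (d - c), by field_simp⟩
  rw [distBound]
  split_ifs with h1 h2 h3
  · exact upperProportion_le_one hcd
  · rw [upperProportion_eq hcd hm]
    have := hA c d le_rfl hcd le_rfl
    rw [hm, mul_div_cancel_right₀ _ hl.ne', h2, one_mul] at this
    rw [measureReal_eq_zero_of_constant_one hcd hφ he this hm (by linarith)]
    simp
  all_goals
    have hC1 : 1 < C := lt_of_le_of_ne hC (Ne.symm h2)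
    obtain ⟨-, hξ1, hξ⟩ := xiPlus_spec hC
    obtain ⟨-, hη⟩ := xiMinus_spec hC
    have hξ0 := xiPlus_pos hC1
    have hη0 := xiMinus_neg hC1
    generalize xiPlus C = ξ at *
    generalize xiMinus C = η at *
    have hL : 0 < ξ - η := by linarith
    -- The level is `u - η` with `u = m + lam + η`, so `lam ≤ -η` is exactly `u ≤ m`.
    rw [upperProportion_eq hcd hm, div_le_iff₀ hl,
      show m + lam = (m + lam + η) - η by ring]
  · refine (measureReal_le_of_le_mean hcd hC0 hξ0 hη0.le hξ hη hφ he hA hm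
      (by linarith)).trans_eq ?_
    field_simp
    ring
  · refine (measureReal_le_exp_of_mean_lt hcd hC0 hξ0 hξ1 hη0 hξ hη hφ he hA hm
      (by linarith)).trans_eq ?_
    rw [show (m - (m + lam + η)) / ξ = -η / ξ + -lam / ξ by field_simp; ring, Real.exp_add]
    field_simp

/-! ### Tools for the extremal functions -/

/-- The tangent line to `C e^x` at any `v` lies below the curve, so the `A_∞` condition may be
checked against a conveniently chosen tangent, which is linear in `φ`. -/
theorem integral_exp_le_of_tangent {φ : ℝ → ℝ} {C c d : ℝ} (hC : 0 ≤ C) (hcd : c < d)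
    (h : ∃ v, ∫ t in c..d, Real.exp (φ t) ≤
      C * Real.exp v * ((1 - v) * (d - c) + ∫ t in c..d, φ t)) :
    ∫ t in c..d, Real.exp (φ t) ≤ C * Real.exp ((∫ t in c..d, φ t) / (d - c)) * (d - c) := by
  obtain ⟨v, hv⟩ := h
  have hl : 0 < d - c := by linarith
  obtain ⟨m, hm⟩ : ∃ m, ∫ t in c..d, φ t = m * (d - c) :=
    ⟨(∫ t in c..d, φ t) / (d - c), by field_simp⟩
  rw [hm] at hv ⊢
  rw [mul_div_cancel_right₀ _ hl.ne']
  have h1 := tangentGap_nonneg v m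
  rw [tangentGap] at h1
  nlinarith [mul_nonneg (mul_nonneg hC hl.le) h1]

/-- Transplants a model function from `[0, 1]` to `[a, b]` by the affine change of variable, under
which averages are invariant. -/
theorem AntitoneOn.exists_upperProportion_eq {f : ℝ → ℝ} {C a b lam p : ℝ} (hC : 0 ≤ C)
    (hab : a < b) (hf : AntitoneOn f (Icc 0 1))
    (hA : ∀ x y, 0 ≤ x → x < y → y ≤ 1 → ∃ v, ∫ t in x..y, Real.exp (f t) ≤
      C * Real.exp v * ((1 - v) * (y - x) + ∫ t in x..y, f t))
    (hmean : ∫ t in (0 : ℝ)..1, f t = 0) (hp0 : 0 ≤ p) (hp1 : p ≤ 1)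
    (hset : ∀ t, 0 ≤ t → t ≤ 1 → (lam ≤ f t ↔ t ≤ p)) :
    ∃ φ : ℝ → ℝ, (fun t => Real.exp (φ t)) ∈ AInftyLE C a b ∧ upperProportion φ a b lam = p := by
  have hl : 0 < b - a := by linarith
  set g : ℝ → ℝ := fun t => t / (b - a) - a / (b - a) with hg
  have hgeq : ∀ t, g t = (t - a) / (b - a) := fun t => by rw [hg]; ring
  have hgmem : ∀ t ∈ Icc a b, g t ∈ Icc (0 : ℝ) 1 := fun t ht => by
    rw [hgeq]
    exact ⟨div_nonneg (by linarith [ht.1]) hl.le, (div_le_one hl).2 (by linarith [ht.2])⟩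
  have hgmono : StrictMono g := fun s t hst => by
    rw [hgeq, hgeq]; gcongr
  have hga : g a = 0 := by rw [hgeq]; simp
  have hgb : g b = 1 := by rw [hgeq]; exact div_self hl.ne'
  have hφ : AntitoneOn (fun t => f (g t)) (Icc a b) := fun s hs t ht hst =>
    hf (hgmem s hs) (hgmem t ht) (hgmono.monotone hst)
  have hφi : IntegrableOn (fun t => f (g t)) (Icc a b) := hφ.integrableOn_isCompact isCompact_Icc
  have hei : IntegrableOn (fun t => Real.exp (f (g t))) (Icc a b) :=
    AntitoneOn.integrableOn_isCompact isCompact_Icc fun s hs t ht hst =>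
      Real.exp_le_exp.2 (hφ hs ht hst)
  have hint : ∀ (h : ℝ → ℝ) (x y : ℝ),
      ∫ t in x..y, h (g t) = (b - a) * ∫ t in (g x)..(g y), h t := fun h x y => by
    rw [hg]
    simp only
    rw [intervalIntegral.integral_comp_div_sub _ hl.ne', smul_eq_mul]
  refine ⟨fun t => f (g t), exp_mem_AInftyLE hφi hei fun c d hac hcd hdb => ?_, ?_⟩
  · refine integral_exp_le_of_tangent hC hcd ?_
    obtain ⟨v, hv⟩ := hA (g c) (g d) (hgmem c ⟨hac, hcd.le.trans hdb⟩).1 (hgmono hcd)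
      (hgmem d ⟨hac.trans hcd.le, hdb⟩).2
    refine ⟨v, ?_⟩
    rw [hint (fun t => Real.exp (f t)), hint f]
    have h1 : d - c = (b - a) * (g d - g c) := by rw [hgeq, hgeq]; field_simp; ring
    rw [h1]
    have := mul_le_mul_of_nonneg_left hv hl.le
    linarith
  · have h0 : ∫ t in a..b, f (g t) = 0 * (b - a) := by rw [hint f, hga, hgb, hmean]; ring
    rw [upperProportion, setAverage_Icc_eq hab.le, h0]
    have hS : {t | t ∈ Icc a b ∧ lam ≤ f (g t) - 0 * (b - a) / (b - a)} =
        Icc a (a + p * (b - a)) := by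
      ext t
      simp only [mem_ofPred_eq, zero_mul, zero_div, sub_zero]
      constructor
      · rintro ⟨ht, h⟩
        rw [hset _ (hgmem t ht).1 (hgmem t ht).2, hgeq, div_le_iff₀ hl] at h
        exact ⟨ht.1, by linarith⟩
      · rintro ⟨h1, h2⟩
        have ht : t ∈ Icc a b := ⟨h1, h2.trans (by nlinarith)⟩
        refine ⟨ht, ?_⟩
        rw [hset _ (hgmem t ht).1 (hgmem t ht).2, hgeq, div_le_iff₀ hl]
        linarith
    rw [hS, Real.volume_Icc, ENNReal.toReal_ofReal (by nlinarith)]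
    field_simp
    ring

section Chord

variable {C ξ η : ℝ}

theorem exp_le_tangent_of_mem_chord (hξη : η < ξ) (hξ : Real.exp (-ξ) = C * (1 - ξ))
    (hη : Real.exp (-η) = C * (1 - η)) {v r : ℝ} (h1 : v - ξ ≤ r) (h2 : r ≤ v - η) :
    Real.exp r ≤ C * Real.exp v * (1 - v + r) := by
  have hL : 0 < ξ - η := by linarith
  have e1 : Real.exp (v - ξ) = Real.exp v * (C * (1 - ξ)) := by
    rw [sub_eq_add_neg, Real.exp_add, hξ]
  have e2 : Real.exp (v - η) = Real.exp v * (C * (1 - η)) := by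
    rw [sub_eq_add_neg, Real.exp_add, hη]
  have ha : 0 ≤ (v - η - r) / (ξ - η) := div_nonneg (by linarith) hL.le
  have hb : 0 ≤ (r - v + ξ) / (ξ - η) := div_nonneg (by linarith) hL.le
  have h := convexOn_exp.2 (mem_univ (v - ξ)) (mem_univ (v - η)) ha hb (by field_simp; ring)
  simp only [smul_eq_mul] at h
  rw [e1, e2] at h
  have e3 : (v - η - r) / (ξ - η) * (v - ξ) + (r - v + ξ) / (ξ - η) * (v - η) = r := by
    field_simp; ring
  rw [e3] at h
  refine h.trans_eq ?_
  field_simp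
  ring

theorem tangent_le_exp_of_chord_le (hξη : η < ξ) (hξ : Real.exp (-ξ) = C * (1 - ξ))
    (hη : Real.exp (-η) = C * (1 - η)) {v r : ℝ} (h1 : v - η ≤ r) :
    C * Real.exp v * (1 - v + r) ≤ Real.exp r := by
  have hL : 0 < ξ - η := by linarith
  have hR : 0 < r - v + ξ := by linarith
  have e1 : Real.exp (v - ξ) = Real.exp v * (C * (1 - ξ)) := by
    rw [sub_eq_add_neg, Real.exp_add, hξ]
  have e2 : Real.exp (v - η) = Real.exp v * (C * (1 - η)) := by
    rw [sub_eq_add_neg, Real.exp_add, hη]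
  have ha : 0 ≤ (r - v + η) / (r - v + ξ) := div_nonneg (by linarith) hR.le
  have hb : 0 ≤ (ξ - η) / (r - v + ξ) := div_nonneg hL.le hR.le
  have h := convexOn_exp.2 (mem_univ (v - ξ)) (mem_univ r) ha hb (by field_simp; ring)
  simp only [smul_eq_mul] at h
  have e3 : (r - v + η) / (r - v + ξ) * (v - ξ) + (ξ - η) / (r - v + ξ) * r = v - η := by
    field_simp; ring
  rw [e3, e1, e2] at h
  refine le_of_mul_le_mul_left ?_ hL
  have h' := mul_le_mul_of_nonneg_left h hR.le
  have e4 : (r - v + ξ) * ((r - v + η) / (r - v + ξ) * (Real.exp v * (C * (1 - ξ))) +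
      (ξ - η) / (r - v + ξ) * Real.exp r) =
      (r - v + η) * (Real.exp v * (C * (1 - ξ))) + (ξ - η) * Real.exp r := by
    field_simp
  rw [e4] at h'
  linarith

theorem integral_tangent {f : ℝ → ℝ} {x y v : ℝ} (hf : IntervalIntegrable f volume x y) :
    ∫ t in x..y, C * Real.exp v * (1 - v + f t) =
      C * Real.exp v * ((1 - v) * (y - x) + ∫ t in x..y, f t) := by
  rw [intervalIntegral.integral_const_mul, intervalIntegral.integral_add intervalIntegrable_const hf,
    intervalIntegral.integral_const, smul_eq_mul, mul_comm (y - x)]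

theorem intervalIntegrable_of_antitoneOn {f : ℝ → ℝ} (hf : AntitoneOn f (Icc 0 1)) {x y : ℝ}
    (hx : 0 ≤ x) (hxy : x ≤ y) (hy : y ≤ 1) :
    IntervalIntegrable f volume x y ∧
      IntervalIntegrable (fun t => Real.exp (f t)) volume x y := by
  have h1 : IntegrableOn f (Icc 0 1) := hf.integrableOn_isCompact isCompact_Icc
  have h2 : IntegrableOn (fun t => Real.exp (f t)) (Icc 0 1) :=
    AntitoneOn.integrableOn_isCompact isCompact_Icc fun s hs t ht hst =>
      Real.exp_le_exp.2 (hf hs ht hst)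
  exact ⟨intervalIntegrable_of_integrableOn_Icc h1 hx hxy hy,
    intervalIntegrable_of_integrableOn_Icc h2 hx hxy hy⟩

theorem integral_exp_le_of_mem_chord (hξη : η < ξ) (hξ : Real.exp (-ξ) = C * (1 - ξ))
    (hη : Real.exp (-η) = C * (1 - η)) {f : ℝ → ℝ} (hf : AntitoneOn f (Icc 0 1)) {x y v : ℝ}
    (hx : 0 ≤ x) (hxy : x ≤ y) (hy : y ≤ 1) (h : ∀ t, x ≤ t → t ≤ y → v - ξ ≤ f t ∧ f t ≤ v - η) :
    ∫ t in x..y, Real.exp (f t) ≤ C * Real.exp v * ((1 - v) * (y - x) + ∫ t in x..y, f t) := by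
  obtain ⟨i1, i2⟩ := intervalIntegrable_of_antitoneOn hf hx hxy hy
  rw [← integral_tangent i1]
  refine intervalIntegral.integral_mono_on hxy i2
    ((intervalIntegrable_const.add i1).const_mul _) fun t ht => ?_
  exact exp_le_tangent_of_mem_chord hξη hξ hη (h t ht.1 ht.2).1 (h t ht.1 ht.2).2

/-- For a nonincreasing `f` it is enough to test the intervals with left endpoint `0`. -/
theorem integral_exp_le_of_integral_zero (hξη : η < ξ) (hξ : Real.exp (-ξ) = C * (1 - ξ))
    (hη : Real.exp (-η) = C * (1 - η)) {f : ℝ → ℝ} (hf : AntitoneOn f (Icc 0 1)) {x y v : ℝ}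
    (hx : 0 ≤ x) (hxy : x ≤ y) (hy : y ≤ 1) (hv : f y = v - ξ)
    (h0 : ∫ t in (0 : ℝ)..y, Real.exp (f t) ≤
      C * Real.exp v * ((1 - v) * y + ∫ t in (0 : ℝ)..y, f t)) :
    ∫ t in x..y, Real.exp (f t) ≤ C * Real.exp v * ((1 - v) * (y - x) + ∫ t in x..y, f t) := by
  rcases le_or_gt (f x) (v - η) with hfx | hfx
  · refine integral_exp_le_of_mem_chord hξη hξ hη hf hx hxy hy fun t h1 h2 => ⟨?_, ?_⟩
    · rw [← hv]
      exact hf ⟨hx.trans h1, h2.trans hy⟩ ⟨hx.trans hxy, hy⟩ h2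
    · exact (hf ⟨hx, hxy.trans hy⟩ ⟨hx.trans h1, h2.trans hy⟩ h1).trans hfx
  -- Now `f > v - η` on `[0, x]`, where the line lies below the exponential. Subtracting this
  -- reverse inequality from the one on `[0, y]` leaves the claim on `[x, y]`.
  · obtain ⟨i1, i2⟩ := intervalIntegrable_of_antitoneOn hf hx hxy hy
    obtain ⟨j1, j2⟩ := intervalIntegrable_of_antitoneOn hf le_rfl hx (hxy.trans hy)
    have hle : ∫ t in (0 : ℝ)..x, C * Real.exp v * (1 - v + f t) ≤
        ∫ t in (0 : ℝ)..x, Real.exp (f t) := by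
      refine intervalIntegral.integral_mono_on hx ((intervalIntegrable_const.add j1).const_mul _)
        j2 fun t ht => ?_
      refine tangent_le_exp_of_chord_le hξη hξ hη (hfx.le.trans ?_)
      exact hf ⟨ht.1, ht.2.trans (hxy.trans hy)⟩ ⟨hx, hxy.trans hy⟩ ht.2
    rw [integral_tangent j1] at hle
    have a1 := intervalIntegral.integral_add_adjacent_intervals j1 i1
    have a2 := intervalIntegral.integral_add_adjacent_intervals j2 i2
    rw [← a1, ← a2] at h0
    linarith

end Chord

/-! ### Extremal functions and sharpness -/

/-- The extremal function takes two values, the ends of the chord of the tangent at `lam + η`, so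
that one tangent serves all subintervals. Mean zero fixes the proportion. -/
theorem exists_upperProportion_eq_linear {C ξ η a b lam : ℝ} (hC : 1 ≤ C) (hab : a < b)
    (h0 : 0 < ξ) (hη0 : η < 0) (hξ : Real.exp (-ξ) = C * (1 - ξ))
    (hη : Real.exp (-η) = C * (1 - η)) (hlam : 0 < lam) (hlam' : lam ≤ -η) :
    ∃ φ : ℝ → ℝ, (fun t => Real.exp (φ t)) ∈ AInftyLE C a b ∧
      upperProportion φ a b lam = 1 - lam / (ξ - η) := by
  have hL : 0 < ξ - η := by linarith
  have hp1 : 1 - lam / (ξ - η) ≤ 1 := by linarith [div_nonneg hlam.le hL.le]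
  have hp0 : 0 ≤ 1 - lam / (ξ - η) := by rw [sub_nonneg, div_le_one hL]; linarith
  set p := 1 - lam / (ξ - η) with hp
  set f : ℝ → ℝ := fun t => if t ≤ p then lam else lam - (ξ - η) with hf
  have hf1 : ∀ t, t ≤ p → f t = lam := fun t h => if_pos h
  have hf2 : ∀ t, p < t → f t = lam - (ξ - η) := fun t h => if_neg (not_le.2 h)
  have hrange : ∀ t, lam + η - ξ ≤ f t ∧ f t ≤ lam + η - η := by
    intro t
    rcases le_or_gt t p with h | h
    · rw [hf1 t h]; constructor <;> linarith
    · rw [hf2 t h]; constructor <;> linarith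
  have hanti : AntitoneOn f (Icc 0 1) := by
    intro s _ t _ hst
    rcases le_or_gt s p with h | h
    · rw [hf1 s h]; linarith [(hrange t).2]
    · rw [hf2 s h, hf2 t (h.trans_le hst)]
  refine hanti.exists_upperProportion_eq (by linarith) hab (fun x y hx hxy hy => ?_) ?_ hp0 hp1 ?_
  · exact ⟨lam + η, integral_exp_le_of_mem_chord (by linarith) hξ hη hanti hx hxy.le hy
      fun t _ _ => hrange t⟩
  · rw [← intervalIntegral.integral_add_adjacent_intervals
      (intervalIntegrable_of_antitoneOn hanti le_rfl hp0 hp1).1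
      (intervalIntegrable_of_antitoneOn hanti hp0 hp1 le_rfl).1,
      intervalIntegral.integral_congr_ae (g := fun _ => lam)
        (Filter.Eventually.of_forall fun t ht => hf1 t (by rw [uIoc_of_le hp0] at ht; exact ht.2)),
      intervalIntegral.integral_congr_ae (g := fun _ => lam - (ξ - η))
        (Filter.Eventually.of_forall fun t ht => hf2 t (by rw [uIoc_of_le hp1] at ht; exact ht.1))]
    simp only [intervalIntegral.integral_const, smul_eq_mul]
    rw [hp]
    field_simp
    ring
  · intro t _ _
    constructor
    · intro h
      by_contra! hn
      rw [hf2 t hn] at h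
      linarith
    · intro h
      rw [hf1 t h]

theorem exists_upperProportion_eq_exp {C ξ η a b lam : ℝ} (hC : 1 ≤ C) (hab : a < b)
    (h0 : 0 < ξ) (hη0 : η < 0) (hξ : Real.exp (-ξ) = C * (1 - ξ))
    (hη : Real.exp (-η) = C * (1 - η)) (hlam : -η < lam) :
    ∃ φ : ℝ → ℝ, (fun t => Real.exp (φ t)) ∈ AInftyLE C a b ∧
      upperProportion φ a b lam = ξ * Real.exp (-η / ξ) / (ξ - η) * Real.exp (-lam / ξ) := by
  have hL : 0 < ξ - η := by linarith
  set u := lam + η with hu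
  have hu0 : 0 < u := by linarith
  set τ := Real.exp (-u / ξ) with hτ
  have hτ0 : 0 < τ := Real.exp_pos _
  have hτ1 : τ ≤ 1 := Real.exp_le_one_iff.2 (div_nonpos_of_nonpos_of_nonneg (by linarith) h0.le)
  have hlogτ : -ξ * Real.log τ = u := by rw [hτ, Real.log_exp]; field_simp
  have hpeq : ξ * Real.exp (-η / ξ) / (ξ - η) * Real.exp (-lam / ξ) = τ * (ξ / (ξ - η)) := by
    rw [hτ, hu, show -(lam + η) / ξ = -η / ξ + -lam / ξ by ring, Real.exp_add]; ring
  rw [hpeq]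
  set p := τ * (ξ / (ξ - η)) with hp
  have hq : ξ / (ξ - η) ≤ 1 := (div_le_one hL).2 (by linarith)
  have hp0 : 0 ≤ p := mul_nonneg hτ0.le (div_nonneg h0.le hL.le)
  have hpτ : p ≤ τ := mul_le_of_le_one_right hτ0.le hq
  -- The step on `[0, τ]` takes the chord ends `u - η = lam` and `u - ξ`, with `p` chosen to give
  -- mean `u` there. The logarithm continues it so that the mean over `[0, y]` is `-ξ log y`, which
  -- equals `u` at `y = τ` and `0` at `y = 1`.
  set f : ℝ → ℝ := fun t =>
    if t ≤ p then lam else if t ≤ τ then u - ξ else -ξ - ξ * Real.log t with hf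
  have hf1 : ∀ t, t ≤ p → f t = lam := fun t h => if_pos h
  have hf2 : ∀ t, p < t → t ≤ τ → f t = u - ξ := fun t h h' => by
    simp only [hf]; rw [if_neg (not_le.2 h), if_pos h']
  have hf3 : ∀ t, τ < t → f t = -ξ - ξ * Real.log t := fun t h => by
    simp only [hf]; rw [if_neg (not_le.2 (hpτ.trans_lt h)), if_neg (not_le.2 h)]
  have hlog : ∀ s t, τ ≤ s → s ≤ t → -ξ - ξ * Real.log t ≤ -ξ - ξ * Real.log s := by
    intro s t hs hst
    have := Real.log_le_log (hτ0.trans_le hs) hst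
    nlinarith
  have hlow : ∀ t, p < t → f t ≤ u - ξ := by
    intro t ht
    rcases le_or_gt t τ with h | h
    · exact (hf2 t ht h).le
    · rw [hf3 t h]; linarith [hlog τ t le_rfl h.le]
  have hanti : AntitoneOn f (Icc 0 1) := by
    intro s _ t _ hst
    rcases le_or_gt s p with h | h
    · rw [hf1 s h]
      rcases le_or_gt t p with h' | h'
      · rw [hf1 t h']
      · linarith [hlow t h']
    rcases le_or_gt s τ with h' | h'
    · rw [hf2 s h h']; exact hlow t (h.trans_le hst)
    · rw [hf3 s h', hf3 t (h'.trans_le hst)]; exact hlog s t h'.le hst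
  have e1 : Real.exp (u - ξ) = Real.exp u * (C * (1 - ξ)) := by
    rw [sub_eq_add_neg, Real.exp_add, hξ]
  have e2 : Real.exp lam = Real.exp u * (C * (1 - η)) := by
    rw [← hη, ← Real.exp_add]; congr 1; ring
  -- Used with `h` the identity and `h = exp`: `H` is a primitive on the logarithmic part, whose
  -- value at `τ` must match the integral over the step.
  have hcomp : ∀ (h H : ℝ → ℝ) (y : ℝ), τ ≤ y → y ≤ 1 →
      (∀ x z, 0 ≤ x → x ≤ z → z ≤ 1 → IntervalIntegrable (fun t => h (f t)) volume x z) →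
      (∀ t, 0 < t → HasDerivAt H (h (-ξ - ξ * Real.log t)) t) →
      h lam * p + h (u - ξ) * (τ - p) = H τ → ∫ t in (0 : ℝ)..y, h (f t) = H y := by
    intro h H y hy hy1 hi hd hH
    have i1 := hi 0 p le_rfl hp0 (hpτ.trans hτ1)
    have i2 := hi p τ hp0 hpτ hτ1
    have i3 := hi τ y hτ0.le hy hy1
    have hc3 : EqOn (fun t => h (f t)) (fun t => h (-ξ - ξ * Real.log t)) (uIoc τ y) :=
      fun t ht => by
        rw [uIoc_of_le hy] at ht
        simp only [hf3 t ht.1]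
    rw [← intervalIntegral.integral_add_adjacent_intervals (i1.trans i2) i3,
      ← intervalIntegral.integral_add_adjacent_intervals i1 i2,
      intervalIntegral.integral_congr_ae (a := 0) (b := p) (g := fun _ => h lam)
        (Filter.Eventually.of_forall fun t ht => by
          rw [uIoc_of_le hp0] at ht; simp only [hf1 t ht.2]),
      intervalIntegral.integral_congr_ae (a := p) (b := τ) (g := fun _ => h (u - ξ))
        (Filter.Eventually.of_forall fun t ht => by
          rw [uIoc_of_le hpτ] at ht; simp only [hf2 t ht.1 ht.2]),
      intervalIntegral.integral_congr_ae (a := τ) (b := y)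
        (g := fun t => h (-ξ - ξ * Real.log t)) (Filter.Eventually.of_forall fun t ht => hc3 ht),
      intervalIntegral.integral_eq_sub_of_hasDerivAt (f := H)
        (fun t ht => hd t (by rw [uIcc_of_le hy] at ht; exact hτ0.trans_le ht.1))
        (i3.congr hc3)]
    simp only [intervalIntegral.integral_const, smul_eq_mul]
    rw [← hH]
    ring
  have hintf : ∀ y, τ ≤ y → y ≤ 1 → ∫ t in (0 : ℝ)..y, f t = -ξ * Real.log y * y := by
    intro y hy hy1
    refine hcomp (fun r => r) (fun t => -ξ * Real.log t * t) y hy hy1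
      (fun x z hx hxz hz => (intervalIntegrable_of_antitoneOn hanti hx hxz hz).1) (fun t ht => ?_) ?_
    · refine (((Real.hasDerivAt_log ht.ne').const_mul (-ξ)).mul (hasDerivAt_id t)).congr_deriv ?_
      simp only [id]
      field_simp
      ring
    · rw [hlogτ, hp, show lam = u - η by ring]
      field_simp
      ring
  have hinte : ∀ y, τ ≤ y → y ≤ 1 →
      ∫ t in (0 : ℝ)..y, Real.exp (f t) = C * Real.exp (-ξ * Real.log y) * y := by
    intro y hy hy1
    refine hcomp Real.exp (fun t => C * Real.exp (-ξ * Real.log t) * t) y hy hy1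
      (fun x z hx hxz hz => (intervalIntegrable_of_antitoneOn hanti hx hxz hz).2) (fun t ht => ?_) ?_
    · refine (((((Real.hasDerivAt_log ht.ne').const_mul (-ξ)).exp).const_mul C).mul
        (hasDerivAt_id t)).congr_deriv ?_
      rw [show -ξ - ξ * Real.log t = -ξ + -ξ * Real.log t by ring, Real.exp_add, hξ]
      simp only [id]
      field_simp
      ring
    · rw [hlogτ, hp, e1, e2]
      field_simp
      ring
  refine hanti.exists_upperProportion_eq (by linarith) hab (fun x y hx hxy hy => ?_) ?_ hp0
    (hpτ.trans hτ1) ?_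
  · rcases le_or_gt y τ with hyτ | hyτ
    · refine ⟨u, integral_exp_le_of_mem_chord (by linarith) hξ hη hanti hx hxy.le hy
        fun t _ ht => ?_⟩
      rcases le_or_gt t p with h | h
      · rw [hf1 t h]; constructor <;> linarith
      · rw [hf2 t h (ht.trans hyτ)]; constructor <;> linarith
    -- With `v` the mean over `[0, y]` one has `f y = v - ξ`, and the condition on `[0, y]` holds
    -- with equality.
    · refine ⟨-ξ * Real.log y, integral_exp_le_of_integral_zero (by linarith) hξ hη hanti hx
        hxy.le hy (by rw [hf3 y hyτ]; ring) ?_⟩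
      rw [hintf y hyτ.le hy, hinte y hyτ.le hy]
      exact le_of_eq (by ring)
  · rw [hintf 1 hτ1 le_rfl]; simp
  · intro t _ _
    constructor
    · intro h
      by_contra! hn
      linarith [hlow t hn]
    · intro h
      rw [hf1 t h]

theorem one_mem_AInftyLE {C a b : ℝ} (hC : 1 ≤ C) :
    (fun _ : ℝ => Real.exp 0) ∈ AInftyLE C a b := by
  refine exp_mem_AInftyLE (φ := fun _ => 0) (integrableOn_const (by simp))
    (integrableOn_const (by simp)) fun c d _ hcd _ => ?_
  simp
  nlinarith

theorem upperProportion_zero {a b lam : ℝ} (hab : a < b) :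
    upperProportion (fun _ => 0) a b lam = if lam ≤ 0 then 1 else 0 := by
  have hl : b - a ≠ 0 := by linarith
  rw [upperProportion_eq (m := 0) hab (by simp)]
  split_ifs with h
  · simp [h, hab.le, hl]
  · simp [h]

theorem exists_upperProportion_eq_distBound {C a b : ℝ} (hC : 1 ≤ C) (hab : a < b) (lam : ℝ) :
    ∃ φ : ℝ → ℝ, (fun t => Real.exp (φ t)) ∈ AInftyLE C a b ∧
      upperProportion φ a b lam = distBound C lam := by
  rw [distBound]
  split_ifs with h1 h2 h3
  -- A constant function is extremal both for `lam ≤ 0` and for `C = 1`.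
  · exact ⟨fun _ => 0, one_mem_AInftyLE hC, by rw [upperProportion_zero hab, if_pos h1]⟩
  · exact ⟨fun _ => 0, one_mem_AInftyLE hC, by rw [upperProportion_zero hab, if_neg h1]⟩
  all_goals
    have hC1 : 1 < C := lt_of_le_of_ne hC (Ne.symm h2)
    obtain ⟨-, -, hξ⟩ := xiPlus_spec hC
    obtain ⟨-, hη⟩ := xiMinus_spec hC
    have hξ0 := xiPlus_pos hC1
    have hη0 := xiMinus_neg hC1
  · exact exists_upperProportion_eq_linear hC hab hξ0 hη0 hξ hη (not_le.1 h1) h3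
  · exact exists_upperProportion_eq_exp hC hab hξ0 hη0 hξ hη (not_le.1 h3)

theorem mainTheorem6 (C : ℝ) (hC : 1 ≤ C) (a b : ℝ) (hab : a < b) (lam : ℝ) :
    (∀ φ : ℝ → ℝ, (fun t => Real.exp (φ t)) ∈ AInftyLE C a b →
      ∀ c d : ℝ, a ≤ c → c < d → d ≤ b →
        upperProportion φ c d lam ≤ distBound C lam) ∧
    (∃ φ : ℝ → ℝ, (fun t => Real.exp (φ t)) ∈ AInftyLE C a b ∧
      upperProportion φ a b lam = distBound C lam) :=
  ⟨fun _ h _ _ hac hcd hdb => upperProportion_le_distBound hC h hac hcd hdb,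
    exists_upperProportion_eq_distBound hC hab lam⟩
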